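/- Let $K$ be a field of characteristic zero, $n\ge 1$, $R=K[x_1,\dots,x_n]$ with the standard grading, and let $0<s<r$ be integers. Let $e_i$ denote the $i$-th elementary symmetric polynomial in $n$ variables and put $f_i=e_i(x_1^r,\dots,x_n^r)$ for $1\le i\le n-1$ and $f_n=e_n(x_1^s,\dots,x_n^s)=(x_1\cdots x_n)^s$. Let $I=(f_1,\dots,f_n)$ and $A=R/I=\bigoplus_{i=0}^c A_i$ with $A_c\ne 0$. Then $f_1,\dots,f_n$ is a regular sequence (so $A$ is a complete intersection), and $A$ has the strong Lefschetz property: $A$ is finite-dimensional and there is $g\in A_1$ such that multiplication by $g^{c-2i}$ is a bijection $A_i\to A_{c-i}$ for all $0\le i\le c/2$. Assume moreover $n\ge 2$ and let $z\in A$ be the image of $x_n$. Multiplication by $z$ on $A$ is nilpotent; let $F_1>F_2>\dots>F_t$ be the distinct sizes of its Jordan blocks and $F_{t+1}=0$. The central simple modules of $(A,z)$ are the graded $A$-modules $$U_i=\frac{(0:z^{F_i})+(z)}{(0:z^{F_{i+1}})+(z)},\qquad 1\le i\le t .$$ Then $t=2$, that is, $(A,z)$ has exactly two central simple modules, and $$U_1\cong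 K[x_1,\dots,x_{n-1}]/(\bar f_1,\dots,\bar f_{n-2},(x_1\cdots x_{n-1})^s),$$ $$U_2\cong K[x_1,\dots,x_{n-1}]/(\bar f_1,\dots,\bar f_{n-2},(x_1\cdots x_{n-1})^{r-s}),$$ where $\bar f_j$ is the image of $f_j$ in $K[x_1,\dots,x_{n-1}]=R/(x_n)$. Both are isomorphisms of $R$-modules ($R$ acting on the right-hand sides through $R\to R/(x_n)$) which respect the gradings up to a shift of degrees. -/

import Mathlib

noncomputable section

namespace CentralSimple

section General

variable {K : Type*} [Field K]

/-- The grading on `A = K[x_1,…,x_n]/I` induced by the total degree: the degree-`i` piece is the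
image of the space of homogeneous polynomials of degree `i`. -/
def quotientGrading {σ : Type*} (I : Ideal (MvPolynomial σ K)) (i : ℕ) :
    Submodule K (MvPolynomial σ K ⧸ I) :=
  (MvPolynomial.homogeneousSubmodule σ K i).map (Ideal.Quotient.mkₐ K I).toLinearMap

variable {A : Type*} [CommRing A] [Algebra K A]

/-- The Strong Lefschetz Property of a graded Artinian `K`-algebra `A = ⊕_{i=0}^c A_i`, `A_c ≠ 0`:
there is `g ∈ A_1` such that multiplication by `g^(c-2i)` is a bijection `A_i → A_{c-i}` for all
`0 ≤ i ≤ c/2`. -/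
def HasSLP (𝒜 : ℕ → Submodule K A) : Prop :=
  Module.Finite K A ∧
  ∃ c : ℕ, 𝒜 c ≠ ⊥ ∧ (∀ i, c < i → 𝒜 i = ⊥) ∧
    ∃ g ∈ 𝒜 1, ∀ i, 2 * i ≤ c →
      Set.BijOn (fun a : A => g ^ (c - 2 * i) * a) (𝒜 i : Set A) (𝒜 (c - i) : Set A)

/-- `(n_1 ≥ n_2 ≥ ⋯ ≥ n_r)` is the list of sizes of the Jordan blocks of the nilpotent
endomorphism `φ`: the space has a basis consisting of strings
`a_i, φ a_i, …, φ^(n_i - 1) a_i` with `φ^(n_i) a_i = 0`. -/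
structure IsJordanBlockSizes {V : Type*} [AddCommGroup V] [Module K V]
    (φ : Module.End K V) (l : List ℕ) : Prop where
  decreasing : l.Pairwise (· ≥ ·)
  pos : ∀ k ∈ l, 0 < k
  exists_basis : ∃ b : Module.Basis (Σ i : Fin l.length, Fin (l.get i)) K V,
    ∀ (i : Fin l.length) (j : Fin (l.get i)),
      φ (b ⟨i, j⟩) = if h : (j : ℕ) + 1 < l.get i then b ⟨i, ⟨(j : ℕ) + 1, h⟩⟩ else 0

/-- The distinct values `F_0 > F_1 > ⋯ > F_{t-1}` of a weakly decreasing list (counted from `0`),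
with `F_i = 0` for `i ≥ t`. -/
def distinctSize (l : List ℕ) (i : ℕ) : ℕ := l.dedup.getD i 0

/-- The ideal `(0 : z^k) + (z)` of `A`. -/
def colonAdd (z : A) (k : ℕ) : Ideal A :=
  (⊥ : Ideal A).colon {z ^ k} ⊔ Ideal.span {z}

/-- The central simple module `((0 : z^F_i) + (z)) / ((0 : z^F_{i+1}) + (z))` of `(A, z)`, where
`l` is the list of Jordan block sizes of multiplication by `z`. The numbering starts at `0`. -/
abbrev CentralSimpleModule (z : A) (l : List ℕ) (i : ℕ) : Type _ :=
  ↥(colonAdd z (distinctSize l i)) ⧸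
    (colonAdd z (distinctSize l (i + 1))).submoduleOf (colonAdd z (distinctSize l i))

/-- The grading of a central simple module induced by the grading `𝒜` of `A`. -/
def centralSimpleGrading (𝒜 : ℕ → Submodule K A) (z : A) (l : List ℕ) (i k : ℕ) :
    Submodule K (CentralSimpleModule z l i) :=
  ((𝒜 k).comap ((colonAdd z (distinctSize l i)).subtype.restrictScalars K)).map
    (((colonAdd z (distinctSize l (i + 1))).submoduleOf
      (colonAdd z (distinctSize l i))).mkQ.restrictScalars K)

/-- Let `π : P → A` and `ρ : P → B` be homomorphisms of `K`-algebras. The graded `A`-module `U` and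
the graded algebra `B` are isomorphic as `P`-modules by an isomorphism which is homogeneous, that
is, which respects the gradings up to a shift by some degree `d`. -/
def IsoUpToShift {P B U : Type*} [CommRing P] [Algebra K P] [CommRing B] [Algebra K B]
    [AddCommGroup U] [Module K U] [Module A U] (π : P →ₐ[K] A) (ρ : P →ₐ[K] B)
    (𝒰 : ℕ → Submodule K U) (ℬ : ℕ → Submodule K B) : Prop :=
  ∃ e : U ≃ₗ[K] B, (∀ (p : P) (u : U), e (π p • u) = ρ p * e u) ∧
    ∃ d : ℕ, (∀ i, i < d → 𝒰 i = ⊥) ∧ ∀ i, (𝒰 (i + d)).map e.toLinearMap = ℬ i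

end General

/-! The polynomial ring has `n = m + 1` variables `x_1, …, x_n`; `x_{j+1}` is `X j`. -/

variable (K : Type*) [Field K]

/-- `f_{j+1} = e_{j+1}(x_1^r, …, x_n^r)` for `j + 1 < n`, and `f_n = e_n(x_1^s, …, x_n^s)`. -/
def gen (m r s : ℕ) (j : Fin (m + 1)) : MvPolynomial (Fin (m + 1)) K :=
  if (j : ℕ) < m then MvPolynomial.expand r (MvPolynomial.esymm (Fin (m + 1)) K (j + 1))
  else MvPolynomial.expand s (MvPolynomial.esymm (Fin (m + 1)) K (m + 1))

/-- The ideal `I = (f_1, …, f_n)`. -/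
def genIdeal (m r s : ℕ) : Ideal (MvPolynomial (Fin (m + 1)) K) :=
  Ideal.span (Set.range (gen K m r s))

/-- The algebra `A = K[x_1, …, x_n]/I`. -/
abbrev Alg (m r s : ℕ) : Type _ := MvPolynomial (Fin (m + 1)) K ⧸ genIdeal K m r s

/-- The image `z` of `x_n` in `A`. -/
def lastVar (m r s : ℕ) : Alg K m r s :=
  Ideal.Quotient.mk (genIdeal K m r s) (MvPolynomial.X (Fin.last m))

/-- The reduction `K[x_1, …, x_n] → K[x_1, …, x_{n-1}]` modulo `x_n`. -/
def killLast (m : ℕ) : MvPolynomial (Fin (m + 1)) K →ₐ[K] MvPolynomial (Fin m) K :=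
  MvPolynomial.aeval (Fin.lastCases 0 MvPolynomial.X)

/-- The ideal `(f̄_1, …, f̄_{n-2}, (x_1 ⋯ x_{n-1})^t)` of `K[x_1, …, x_{n-1}]`, where `f̄_j` is the
reduction of `f_j` modulo `x_n`. -/
def reducedIdeal (m r s t : ℕ) : Ideal (MvPolynomial (Fin m) K) :=
  Ideal.span ({p | ∃ j : Fin (m + 1), (j : ℕ) + 1 < m ∧ p = killLast K m (gen K m r s j)} ∪
    {(∏ i : Fin m, MvPolynomial.X i) ^ t})

/-- The graded module `U` over `A` is isomorphic, up to a shift of degrees, to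
`K[x_1, …, x_{n-1}]/(f̄_1, …, f̄_{n-2}, (x_1 ⋯ x_{n-1})^t)`, on which `K[x_1, …, x_n]` acts
through reduction modulo `x_n`. -/
def IsoReduced (m r s t : ℕ) {U : Type*} [AddCommGroup U] [Module K U] [Module (Alg K m r s) U]
    (𝒰 : ℕ → Submodule K U) : Prop :=
  IsoUpToShift (Ideal.Quotient.mkₐ K (genIdeal K m r s))
    ((Ideal.Quotient.mkₐ K (reducedIdeal K m r s t)).comp (killLast K m))
    𝒰 (quotientGrading (reducedIdeal K m r s t))

end CentralSimple

end

/-!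
Write `z` for the last variable `x_n`, `P` for the product `x_1 ⋯ x_{n-1}` of the other ones, and
`J` for the ideal generated by `f_1, …, f_{n-1}`, so that `I = J + ((P z)^s)`.

**Regularity and Hilbert function.** Setting `z = 0` turns `e_i(x_1^r, …, x_n^r)` into the same
polynomial in one variable less. By induction on `n`, `z` is a nonzerodivisor modulo `J`, by
symmetry so is each variable, and hence so is `(P z)^s` (`regularMod_powEsymm`, `isRegular_gen`).
The Hilbert series of `A` is then a product of polynomials `1 + X + ⋯ + X^(d-1)` and therefore
palindromic (`finrank_quotientGrading_symm`). Thus the strong Lefschetz property only requires that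
multiplication by `g^(c-2i)` be surjective, which is the predicate `LefschetzOnto`.

**Central simple modules.** Modulo `J` one has `P^r = ± z^(r(n-1))`, because the elementary
symmetric polynomials in `x_1^r, …, x_{n-1}^r` are, up to sign, powers of `z^r`. As `z` is a
nonzerodivisor modulo `J`, one can cancel `z` and compute `(0 : z^k) + (z)` in `A`: it is `(z)` for
`k < s`, `(P^s, z)` for `s ≤ k < r(n-1) + s`, and `A` from there on (`mk_mem_colonAdd_of_lt`,
`mk_mem_colonAdd_of_le`, `colonAdd_eq_top`). A nilpotent multiplication by `z` has a Jordan block of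
size `k + 1` exactly if this filtration jumps between `k` and `k + 1`
(`IsJordanBlockSizes.mem_iff`), so the distinct block sizes are `r(n-1) + s` and `s`. The first
central simple module `A/(P^s, z)` is the algebra `A` of the exponents `(r, s)` in `n - 1`
variables. The second one, `(P^s, z)/(z)`, is generated by the class of `P^s`, and the colon ideal
of `P^s` gives the algebra of the exponents `(r, r - s)`.

**The strong Lefschetz property.** It is proved by induction on `n`, for all `s` at once, since the
central simple modules of `A` are algebras of the same kind. Two such algebras have a common
Lefschetz element, because being one is an open condition on a line of linear forms
(`exists_common_lefschetz`). The substitution `z ↦ t z` deforms `A`, as `t` tends to `0`, into an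
algebra in which `z` splits off as a tensor factor from the two central simple modules, up to an
extension. Such a tensor product with `K[z]/(z^F)` keeps the Lefschetz property
(`LefschetzOnto.tensor`): by the primitive decomposition this reduces to the case of
`K[x, y]/(x^a, y^b)`, where an argument with Wronskians applies (`exists_lefschetz_bivariate`). The
two tensor products have the same centre of symmetry, so that the property passes to the extension
(`LefschetzOnto.of_extension`), and semicontinuity brings it back to `A` (`LefschetzOnto.inherit`).
-/

noncomputable section

namespace CentralSimple

/-! ### The strong Lefschetz property in two variables -/

section Bivariate

open Polynomial

theorem pow_pred_dvd_wronskian_left {R : Type*} [CommRing R] {f g h : R[X]} {n : ℕ}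
    (hd : h ^ n ∣ f) : h ^ (n - 1) ∣ wronskian f g := by
  have h1 : h ^ (n - 1) ∣ derivative f := pow_sub_one_dvd_derivative_of_pow_dvd hd
  have h2 : h ^ (n - 1) ∣ f := (pow_dvd_pow h (Nat.sub_le n 1)).trans hd
  exact dvd_sub (h2.mul_right _) (h1.mul_right _)

theorem isCoprime_X_pow_X_add_one_pow {K : Type*} [Field K] (a k : ℕ) :
    IsCoprime ((X : K[X]) ^ a) ((X + 1) ^ k) :=
  IsCoprime.pow ⟨-1, 1, by ring⟩

variable {K : Type*} [Field K] [CharZero K]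

theorem wronskian_ne_zero_of_natDegree_ne {f g : K[X]} (hf : f ≠ 0) (hg : g ≠ 0)
    (h : f.natDegree ≠ g.natDegree) : wronskian f g ≠ 0 := by
  intro hw
  rw [wronskian, sub_eq_zero] at hw
  have h1 := congrArg leadingCoeff hw
  rw [leadingCoeff_mul, leadingCoeff_mul, leadingCoeff_derivative, leadingCoeff_derivative] at h1
  have hf' := leadingCoeff_ne_zero.2 hf
  have hg' := leadingCoeff_ne_zero.2 hg
  apply h
  have h2 : f.leadingCoeff * g.leadingCoeff * ((f.natDegree : K) - g.natDegree) = 0 := by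
    linear_combination -h1
  have h3 := (mul_eq_zero.1 h2).resolve_left (mul_ne_zero hf' hg')
  exact_mod_cast sub_eq_zero.1 h3

/-- Dehomogenized injectivity of `(x + y)^k` from degree `i` to degree `D = i + k` of
`K[x, y]/(x^a, y^b)`, with the relations made explicit. If `q₁` and `q₂` are nonzero, then any two
of the three summands have the same Wronskian up to sign. It is divisible by
`X^(a - 1) (X + 1)^(k - 1)`, and its degree is too small for this unless it vanishes; it does not
vanish, because `X^a q₁` and `q₂` have different degrees. The other cases are settled by
divisibility and by degrees. -/
theorem eq_zero_of_trinomial_relation {a b i k D : ℕ} (hD : D = i + k) (hab : i + D + 2 = a + b)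
    (ha : a ≤ D + 1) (hb : b ≤ D + 1) {p q₁ q₂ : K[X]} (hp : p.degree < (i + 1 : ℕ))
    (hq₁ : q₁.degree < (D + 1 - a : ℕ)) (hq₂ : q₂.degree < (D + 1 - b : ℕ))
    (h : (X + 1) ^ k * p + X ^ a * q₁ + q₂ = 0) : p = 0 ∧ q₁ = 0 ∧ q₂ = 0 := by
  have hX1 : ((X : K[X]) + 1).natDegree = 1 := by
    simpa using natDegree_X_add_C (1 : K)
  have hX1m : ((X : K[X]) + 1).Monic := by simpa using monic_X_add_C (1 : K)
  have hXa : ((X : K[X]) ^ a) ≠ 0 := pow_ne_zero _ X_ne_zero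
  have hXk : ((X + 1 : K[X]) ^ k) ≠ 0 := pow_ne_zero _ hX1m.ne_zero
  by_cases hC : q₂ = 0
  · subst hC
    have hdvd : X ^ a ∣ (X + 1) ^ k * p := ⟨-q₁, by linear_combination h⟩
    have hdvd' := (isCoprime_X_pow_X_add_one_pow (K := K) a k).dvd_of_dvd_mul_left hdvd
    have hp0 : p = 0 := by
      apply eq_zero_of_dvd_of_degree_lt hdvd'
      rw [degree_X_pow]
      exact hp.trans_le (by exact_mod_cast (by omega))
    subst hp0
    refine ⟨rfl, ?_, rfl⟩
    simpa [hXa] using h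
  · exfalso
    have hbD : q₂.natDegree < D + 1 - b := (natDegree_lt_iff_degree_lt hC).2 hq₂
    by_cases hB : q₁ = 0
    · subst hB
      have hp0 : p ≠ 0 := by rintro rfl; simp at h; exact hC h
      have h2 : q₂ = - ((X + 1) ^ k * p) := by linear_combination h
      have h3 : q₂.natDegree = k + p.natDegree := by
        rw [h2, natDegree_neg, natDegree_mul hXk hp0, natDegree_pow, hX1, mul_one]
      omega
    · have haD : q₁.natDegree < D + 1 - a := (natDegree_lt_iff_degree_lt hB).2 hq₁
      have hB' : X ^ a * q₁ ≠ 0 := mul_ne_zero hXa hB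
      have hdB : (X ^ a * q₁).natDegree = a + q₁.natDegree := by
        rw [natDegree_mul hXa hB, natDegree_X_pow]
      -- `deg (X^a q₁) ≥ a > D - b ≥ deg q₂` when `a + b > D`, which holds as `a + b = i + D + 2`.
      have hw : wronskian (X ^ a * q₁) q₂ ≠ 0 :=
        wronskian_ne_zero_of_natDegree_ne hB' hC (by omega)
      have e1 : wronskian ((X + 1) ^ k * p) (X ^ a * q₁) = wronskian (X ^ a * q₁) q₂ :=
        wronskian_eq_of_sum_zero h
      have e2 : wronskian (X ^ a * q₁) q₂ = wronskian q₂ ((X + 1) ^ k * p) :=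
        wronskian_eq_of_sum_zero (by rw [← h]; ring)
      have d1 : (X + 1 : K[X]) ^ (k - 1) ∣ wronskian (X ^ a * q₁) q₂ :=
        e1 ▸ pow_pred_dvd_wronskian_left (Dvd.intro _ rfl)
      have d2 : (X : K[X]) ^ (a - 1) ∣ wronskian (X ^ a * q₁) q₂ :=
        pow_pred_dvd_wronskian_left (Dvd.intro _ rfl)
      have d3 := (isCoprime_X_pow_X_add_one_pow (K := K) (a - 1) (k - 1)).mul_dvd d2 d1
      have n1 := natDegree_le_of_dvd d3 hw
      rw [natDegree_mul (pow_ne_zero _ X_ne_zero) (pow_ne_zero _ hX1m.ne_zero), natDegree_pow,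
        natDegree_pow, hX1, natDegree_X] at n1
      have n2 := natDegree_wronskian_lt_add (e2 ▸ hw)
      rw [← e2] at n2
      have n3 : ((X + 1) ^ k * p).natDegree ≤ k + i := by
        by_cases hp0 : p = 0
        · simp [hp0]
        · have := (natDegree_lt_iff_degree_lt hp0).2 hp
          rw [natDegree_mul hXk hp0, natDegree_pow, hX1]
          omega
      omega

/-- The spaces of triples `(p, q₁, q₂)` and of polynomials of degree at most `D` have the same
dimension, so that injectivity implies surjectivity. -/
theorem exists_trinomial_relation {a b i k D : ℕ} (hD : D = i + k) (hab : i + D + 2 = a + b)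
    (ha : a ≤ D + 1) (hb : b ≤ D + 1) {f : K[X]} (hf : f.degree < (D + 1 : ℕ)) :
    ∃ p q₁ q₂ : K[X], p.degree < (i + 1 : ℕ) ∧ q₁.degree < (D + 1 - a : ℕ) ∧
      q₂.degree < (D + 1 - b : ℕ) ∧ f = (X + 1) ^ k * p + X ^ a * q₁ + q₂ := by
  let φ : (degreeLT K (i + 1) × degreeLT K (D + 1 - a) × degreeLT K (D + 1 - b)) →ₗ[K] K[X] :=
    LinearMap.coprod ((LinearMap.mulLeft K ((X + 1) ^ k)).comp (degreeLT K (i + 1)).subtype)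
      (LinearMap.coprod ((LinearMap.mulLeft K (X ^ a)).comp (degreeLT K (D + 1 - a)).subtype)
        (degreeLT K (D + 1 - b)).subtype)
  have hφ (x) : φ x = (X + 1) ^ k * (x.1 : K[X]) + X ^ a * (x.2.1 : K[X]) + (x.2.2 : K[X]) := by
    simp [φ, add_assoc]
  have hX1 : ((X : K[X]) + 1).degree = 1 := by simpa using degree_X_add_C (1 : K)
  have hmem (x) : φ x ∈ degreeLT K (D + 1) := by
    rw [hφ]
    refine add_mem (add_mem ?_ ?_) ?_
    · rw [mem_degreeLT, mul_comm]
      by_cases h0 : (x.1 : K[X]) = 0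
      · rw [h0, zero_mul, degree_zero]; exact WithBot.bot_lt_coe _
      · have h1 := (natDegree_lt_iff_degree_lt h0).2 (mem_degreeLT.1 x.1.2)
        refine (degree_le_natDegree).trans_lt ?_
        have h2 : ((x.1 : K[X]) * (X + 1) ^ k).natDegree ≤ (x.1 : K[X]).natDegree + k := by
          refine natDegree_mul_le.trans ?_
          have : ((X : K[X]) + 1).natDegree ≤ 1 := natDegree_le_of_degree_le hX1.le
          have := natDegree_pow_le_of_le k this
          omega
        exact_mod_cast (by omega)
    · rw [mem_degreeLT]
      by_cases h0 : (x.2.1 : K[X]) = 0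
      · rw [h0, mul_zero, degree_zero]; exact WithBot.bot_lt_coe _
      · have h1 := (natDegree_lt_iff_degree_lt h0).2 (mem_degreeLT.1 x.2.1.2)
        refine (degree_le_natDegree).trans_lt ?_
        have h2 : (X ^ a * (x.2.1 : K[X])).natDegree ≤ a + (x.2.1 : K[X]).natDegree := by
          refine natDegree_mul_le.trans ?_
          rw [natDegree_X_pow]
        exact_mod_cast (by omega)
    · exact degreeLT_mono (by omega) x.2.2.2
  let ψ := φ.codRestrict (degreeLT K (D + 1)) hmem
  have hinj : Function.Injective ψ := by
    rw [← LinearMap.ker_eq_bot, LinearMap.ker_eq_bot']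
    intro x hx
    have h0 : φ x = 0 := congrArg Subtype.val hx
    rw [hφ] at h0
    obtain ⟨h1, h2, h3⟩ := eq_zero_of_trinomial_relation hD hab ha hb (mem_degreeLT.1 x.1.2)
      (mem_degreeLT.1 x.2.1.2) (mem_degreeLT.1 x.2.2.2) h0
    exact Prod.ext (Subtype.ext h1) (Prod.ext (Subtype.ext h2) (Subtype.ext h3))
  have hfin (n : ℕ) : Module.finrank K (degreeLT K n) = n := by
    rw [(degreeLTEquiv K n).finrank_eq, Module.finrank_fin_fun]
  have hfd (n : ℕ) : FiniteDimensional K (degreeLT K n) :=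
    Module.Finite.equiv (degreeLTEquiv K n).symm
  have hsurj : Function.Surjective ψ := by
    refine (LinearMap.injective_iff_surjective_of_finrank_eq_finrank ?_).1 hinj
    rw [Module.finrank_prod, Module.finrank_prod, hfin, hfin, hfin, hfin]
    omega
  obtain ⟨x, hx⟩ := hsurj ⟨f, mem_degreeLT.2 hf⟩
  refine ⟨x.1, x.2.1, x.2.2, mem_degreeLT.1 x.1.2, mem_degreeLT.1 x.2.1.2,
    mem_degreeLT.1 x.2.2.2, ?_⟩
  rw [← hφ]
  exact (congrArg Subtype.val hx).symm

/-- The case of `exists_lefschetz_bivariate` in which neither exponent exceeds `i + k + 1`. It is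
the homogenization of `exists_trinomial_relation`. A relation of degree `i + k + 1` is not used,
which is recorded for the reduction of the general case. -/
theorem exists_lefschetz_bivariate_of_le {a b i k : ℕ} (hab : i + (i + k) + 2 = a + b)
    (ha : a ≤ i + k + 1) (hb : b ≤ i + k + 1) {α β : ℕ} (hαβ : α + β = i + k) :
    ∃ u v w : MvPolynomial (Fin 2) K, u.IsHomogeneous i ∧
      (a = i + k + 1 → v = 0) ∧ (b = i + k + 1 → w = 0) ∧
      (MvPolynomial.X 0 ^ α * MvPolynomial.X 1 ^ β : MvPolynomial (Fin 2) K) =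
        (MvPolynomial.X 0 + MvPolynomial.X 1) ^ k * u + MvPolynomial.X 0 ^ a * v
          + MvPolynomial.X 1 ^ b * w := by
  obtain ⟨p, q₁, q₂, hp, hq₁, hq₂, h⟩ := exists_trinomial_relation (K := K) (f := X ^ α) rfl hab
    ha hb (by rw [degree_X_pow]; exact_mod_cast (by omega))
  refine ⟨p.homogenize i, q₁.homogenize (i + k - a), q₂.homogenize (i + k - b),
    isHomogeneous_homogenize p, fun h0 => ?_, fun h0 => ?_, ?_⟩
  · rw [h0, Nat.sub_self, Nat.cast_zero] at hq₁
    rw [degree_eq_bot.1 (Nat.WithBot.lt_zero_iff.1 hq₁), homogenize_zero]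
  · rw [h0, Nat.sub_self, Nat.cast_zero] at hq₂
    rw [degree_eq_bot.1 (Nat.WithBot.lt_zero_iff.1 hq₂), homogenize_zero]
  have hX1 : ((X : K[X]) + 1).natDegree ≤ 1 := by
    simpa using (natDegree_X_add_C (1 : K)).le
  have hnat {q : K[X]} {n : ℕ} (hq : q.degree < (n + 1 : ℕ)) : q.natDegree ≤ n :=
    natDegree_le_of_degree_le (by
      rw [degree_le_iff_coeff_zero]; intro m hm
      exact coeff_eq_zero_of_degree_lt (hq.trans_le (by exact_mod_cast hm)))
  have e0 : homogenize (X ^ α : K[X]) (i + k) = MvPolynomial.X 0 ^ α * MvPolynomial.X 1 ^ β := by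
    rw [homogenize_X_pow (by omega)]; congr 2; omega
  have ek : homogenize ((X + 1 : K[X]) ^ k) k = (MvPolynomial.X 0 + MvPolynomial.X 1) ^ k := by
    have := homogenize_finsetProd (s := Finset.range k) (p := fun _ => (X + 1 : K[X]))
      (n := fun _ => 1) (fun _ _ => hX1)
    simpa [homogenize_add, homogenize_X] using this
  rw [← e0, h, homogenize_add, homogenize_add]
  congr 1
  · congr 1
    · rw [add_comm i k, homogenize_mul _ _ (by simpa using natDegree_pow_le_of_le k hX1) (hnat hp),
        ek]
    · by_cases h0 : q₁ = 0
      · simp [h0]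
      · have h1 := (natDegree_lt_iff_degree_lt h0).2 hq₁
        have h2 : i + k = a + (i + k - a) := by omega
        conv_lhs => rw [h2]
        rw [homogenize_mul _ _ (natDegree_X_pow_le a) (by omega), homogenize_X_pow le_rfl]
        simp
  · by_cases h0 : q₂ = 0
    · simp [h0]
    · have h1 := (natDegree_lt_iff_degree_lt h0).2 hq₂
      have h2 : i + k = b + (i + k - b) := by omega
      conv_lhs => rw [← one_mul q₂, h2]
      rw [homogenize_mul _ _ (by simp) (by omega), homogenize_one]

/-- Surjectivity half of the strong Lefschetz property of `K[x, y]/(x^a, y^b)`: multiplication by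
`(x + y)^k` maps the forms of degree `i` onto those of degree `i + k` when `2 i + k` is the socle
degree `a + b - 2`. -/
theorem exists_lefschetz_bivariate {a b i k : ℕ} (ha₀ : 0 < a) (hb₀ : 0 < b)
    (hab : i + (i + k) + 2 = a + b) {α β : ℕ} (hαβ : α + β = i + k) :
    ∃ u v w : MvPolynomial (Fin 2) K, u.IsHomogeneous i ∧
      (MvPolynomial.X 0 ^ α * MvPolynomial.X 1 ^ β : MvPolynomial (Fin 2) K) =
        (MvPolynomial.X 0 + MvPolynomial.X 1) ^ k * u + MvPolynomial.X 0 ^ a * v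
          + MvPolynomial.X 1 ^ b * w := by
  have hl (n : ℕ) :
      ((MvPolynomial.X 0 + MvPolynomial.X 1 : MvPolynomial (Fin 2) K) ^ n).IsHomogeneous n := by
    simpa using ((MvPolynomial.isHomogeneous_X K (0 : Fin 2)).add
      (MvPolynomial.isHomogeneous_X K (1 : Fin 2))).pow n
  -- A power of a variable exceeding the degree `i + k` plays no role, so the exponent of the
  -- variable may be lowered to `i + k + 1` while `k` is raised.
  by_cases ha : a ≤ i + k + 1
  · by_cases hb : b ≤ i + k + 1
    · obtain ⟨u, v, w, hu, -, -, h⟩ := exists_lefschetz_bivariate_of_le (K := K) hab ha hb hαβ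
      exact ⟨u, v, w, hu, h⟩
    · obtain ⟨u, v, w, hu, -, hw, h⟩ := exists_lefschetz_bivariate_of_le (K := K) (a := a)
        (b := i + k + 1) (i := a - 1) (k := i + k + 1 - a) (by omega) (by omega) (by omega)
        (hαβ.trans (by omega))
      refine ⟨(MvPolynomial.X 0 + MvPolynomial.X 1) ^ (i + 1 - a) * u, v, 0, ?_, ?_⟩
      · convert (hl (i + 1 - a)).mul hu using 1
        omega
      · rw [h, hw (by omega), ← mul_assoc, ← pow_add, mul_zero, mul_zero,
          show k + (i + 1 - a) = i + k + 1 - a by omega]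
  · obtain ⟨u, v, w, hu, hv, -, h⟩ := exists_lefschetz_bivariate_of_le (K := K) (a := i + k + 1)
      (b := b) (i := b - 1) (k := i + k + 1 - b) (by omega) (by omega) (by omega)
      (hαβ.trans (by omega))
    refine ⟨(MvPolynomial.X 0 + MvPolynomial.X 1) ^ (i + 1 - b) * u, 0, w, ?_, ?_⟩
    · convert (hl (i + 1 - b)).mul hu using 1
      omega
    · rw [h, hv (by omega), ← mul_assoc, ← pow_add, mul_zero, mul_zero,
        show k + (i + 1 - b) = i + k + 1 - b by omega]

end Bivariate

/-! ### Lefschetz elements, tensor products and semicontinuity -/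

section Lefschetz

open MvPolynomial

variable {K : Type*} [Field K] {σ : Type*}

/-- The polynomials congruent modulo `I` to a product `g^k u` with `u` homogeneous of degree `i`. -/
def lefschetzImage (I : Ideal (MvPolynomial σ K)) (g : MvPolynomial σ K) (i k : ℕ) :
    Submodule K (MvPolynomial σ K) :=
  (homogeneousSubmodule σ K i).map (LinearMap.mulLeft K (g ^ k)) ⊔ I.restrictScalars K

/-- The surjectivity half of the strong Lefschetz property of `K[σ]/I` with respect to the class of
`g` and the socle degree `c`: for `2 i + k = c`, multiplication by `g^k` maps degree `i` onto degree
`i + k`. -/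
def LefschetzOnto (I : Ideal (MvPolynomial σ K)) (g : MvPolynomial σ K) (c : ℕ) : Prop :=
  ∀ i k, 2 * i + k = c → homogeneousSubmodule σ K (i + k) ≤ lefschetzImage I g i k

/-- `K[σ]/I` vanishes in all degrees greater than `c`. -/
def VanishesAbove (I : Ideal (MvPolynomial σ K)) (c : ℕ) : Prop :=
  ∀ d, c < d → homogeneousSubmodule σ K d ≤ I.restrictScalars K

theorem mem_lefschetzImage {I : Ideal (MvPolynomial σ K)} {g p : MvPolynomial σ K} {i k : ℕ} :
    p ∈ lefschetzImage I g i k ↔ ∃ u, u.IsHomogeneous i ∧ p - g ^ k * u ∈ I := by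
  rw [lefschetzImage, Submodule.mem_sup]
  constructor
  · rintro ⟨_, ⟨u, hu, rfl⟩, z, hz, rfl⟩
    exact ⟨u, hu, by simpa using hz⟩
  · rintro ⟨u, hu, h⟩
    exact ⟨_, ⟨u, hu, rfl⟩, _, h, by simp⟩

theorem mem_lefschetzImage_of_mem {I : Ideal (MvPolynomial σ K)} {g p : MvPolynomial σ K}
    {i k : ℕ} (hp : p ∈ I) : p ∈ lefschetzImage I g i k :=
  Submodule.mem_sup_right (S := (homogeneousSubmodule σ K i).map _) hp

theorem isHomogeneous_pow_of_linear {g : MvPolynomial σ K} (hg : g.IsHomogeneous 1) (n : ℕ) :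
    (g ^ n).IsHomogeneous n := by
  simpa using hg.pow n

/-- Primitive decomposition: modulo `J`, a form of degree `d` is a sum of forms `l^j v`, where `v`
is a form of degree `e ≤ c / 2` which is primitive, that is, killed by `l^(c + 1 - 2 e)`. -/
theorem LefschetzOnto.mem_of_primitive {J : Ideal (MvPolynomial σ K)} {l : MvPolynomial σ K}
    {c : ℕ} (hl : l.IsHomogeneous 1) (hJ : LefschetzOnto J l c) (hv : VanishesAbove J c)
    {d : ℕ} {T : Submodule K (MvPolynomial σ K)} (hJT : ∀ p ∈ J, p ∈ T)
    (hT : ∀ e j v, e + j = d → 2 * e ≤ c → v.IsHomogeneous e → l ^ (c + 1 - 2 * e) * v ∈ J →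
      l ^ j * v ∈ T) {q : MvPolynomial σ K} (hq : q.IsHomogeneous d) : q ∈ T := by
  -- In degrees `d ≤ c / 2`, subtract from `q` a multiple `l v` such that `q - l v` is primitive.
  have low : ∀ d, 2 * d ≤ c → ∀ T : Submodule K (MvPolynomial σ K), (∀ p ∈ J, p ∈ T) →
      (∀ e j v, e + j = d → 2 * e ≤ c → v.IsHomogeneous e → l ^ (c + 1 - 2 * e) * v ∈ J →
      l ^ j * v ∈ T) → ∀ q : MvPolynomial σ K, q.IsHomogeneous d → q ∈ T := by
    intro d
    induction d with
    | zero =>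
      intro _ T _ hT q hq
      have h1 : l ^ (c + 1) * q ∈ J := hv (c + 1) (by omega) (by
        simpa using (isHomogeneous_pow_of_linear hl (c + 1)).mul hq)
      simpa using hT 0 0 q rfl (by omega) hq (by simpa using h1)
    | succ d ih =>
      intro hd T hJT hT q hq
      obtain ⟨v, hv1, hv2⟩ := mem_lefschetzImage.1 (hJ d (c - 2 * d) (by omega)
        (show l ^ (c + 1 - 2 * (d + 1)) * q ∈ _ by
          rw [mem_homogeneousSubmodule]
          convert (isHomogeneous_pow_of_linear hl (c + 1 - 2 * (d + 1))).mul hq using 1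
          omega))
      have h1 : q - l * v ∈ T := by
        have hlv : (l * v).IsHomogeneous (d + 1) := by
          rw [add_comm]; exact hl.mul hv1
        simpa using hT (d + 1) 0 (q - l * v) rfl hd (hq.sub hlv) (by
          rw [mul_sub, ← mul_assoc, ← pow_succ]
          rwa [show c + 1 - 2 * (d + 1) + 1 = c - 2 * d by omega])
      have h2 : v ∈ T.comap (LinearMap.mulLeft K l) := by
        refine ih (by omega) _ (fun p hp => hJT (l * p) (J.mul_mem_left _ hp)) ?_ v hv1
        intro e j w he hec hw hwJ
        have := hT e (j + 1) w (by omega) hec hw hwJ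
        simpa [pow_succ', mul_assoc] using this
      simpa using add_mem h1 h2
  by_cases hd : 2 * d ≤ c
  · exact low d hd T hJT hT q hq
  -- In higher degrees, `q` is a multiple of a form of degree `c - d`.
  · by_cases hdc : c < d
    · exact hJT q (hv d hdc hq)
    · obtain ⟨u, hu, h⟩ := mem_lefschetzImage.1 (hJ (c - d) (2 * d - c) (by omega) (x := q) (by
        rw [mem_homogeneousSubmodule]; convert hq using 1; omega))
      have h2 : u ∈ T.comap (LinearMap.mulLeft K (l ^ (2 * d - c))) := by
        refine low (c - d) (by omega) _
          (fun p hp => hJT (l ^ (2 * d - c) * p) (J.mul_mem_left _ hp)) ?_ u hu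
        intro e j w he hec hw hwJ
        have := hT e (2 * d - c + j) w (by omega) hec hw hwJ
        simpa [pow_add, mul_assoc] using this
      simpa using add_mem (hJT _ h) h2

/-- The forms of degree `d` are spanned by the products of a power of the last variable and a form
in the other variables. -/
theorem homogeneousSubmodule_le_of_last {N : ℕ} {d : ℕ}
    {T : Submodule K (MvPolynomial (Fin (N + 1)) K)}
    (hT : ∀ b e q, b + e = d → q.IsHomogeneous e →
      X (Fin.last N) ^ b * rename Fin.castSucc q ∈ T) :
    homogeneousSubmodule (Fin (N + 1)) K d ≤ T := by
  intro p hp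
  rw [p.as_sum]
  refine sum_mem fun s hs => ?_
  have hsd : s.degree = d := by
    by_contra hne
    exact mem_support_iff.1 hs (hp.coeff_eq_zero hne)
  rw [Finsupp.degree_eq_sum, Fin.sum_univ_castSucc] at hsd
  have := hT (s (Fin.last N)) _ (C (coeff s p) * ∏ i, X i ^ s (Fin.castSucc i)) (by
    rw [add_comm]; exact hsd) (by
      refine IsHomogeneous.C_mul ?_ _
      exact IsHomogeneous.prod _ _ _ fun i _ => isHomogeneous_X_pow i _)
  convert this using 1
  rw [monomial_eq, Finsupp.prod_fintype _ _ (by simp), Fin.prod_univ_castSucc]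
  simp [map_prod]
  ring

/-- The Lefschetz property passes from `K[σ]/J` to its tensor product with `K[z]/(z^F)`, for the
element `l + z`: the string `v, l v, l² v, …` of a primitive form `v` of degree `e` spans a copy of
`K[y]/(y^(c + 1 - 2 e))`, so that the bivariate case applies. -/
theorem LefschetzOnto.tensor [CharZero K] {N : ℕ} {J : Ideal (MvPolynomial (Fin N) K)}
    {l : MvPolynomial (Fin N) K} {c F : ℕ} (hl : l.IsHomogeneous 1)
    (hJ : LefschetzOnto J l c) (hv : VanishesAbove J c) (hF : 0 < F)
    {I : Ideal (MvPolynomial (Fin (N + 1)) K)} (hJI : ∀ p ∈ J, rename Fin.castSucc p ∈ I)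
    (hFI : X (Fin.last N) ^ F ∈ I) :
    LefschetzOnto I (rename Fin.castSucc l + X (Fin.last N)) (c + F - 1) := by
  intro i k hik
  refine homogeneousSubmodule_le_of_last fun b d q hbd hq => ?_
  let T : Submodule K (MvPolynomial (Fin N) K) :=
    (lefschetzImage I (rename Fin.castSucc l + X (Fin.last N)) i k).comap
      ((LinearMap.mulLeft K (X (Fin.last N) ^ b)).comp (rename Fin.castSucc).toLinearMap)
  change q ∈ T
  refine hJ.mem_of_primitive hl hv (fun p hp => ?_) (fun e j v hej hec hve hvJ => ?_) hq
  · exact mem_lefschetzImage_of_mem (I.mul_mem_left _ (hJI p hp))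
  change X (Fin.last N) ^ b * rename Fin.castSucc (l ^ j * v) ∈
    lefschetzImage I (rename Fin.castSucc l + X (Fin.last N)) i k
  rw [map_mul, map_pow]
  have hvI : rename Fin.castSucc l ^ (c + 1 - 2 * e) * rename Fin.castSucc v ∈ I := by
    rw [← map_pow, ← map_mul]; exact hJI _ hvJ
  by_cases hei : e ≤ i
  · obtain ⟨u, v', w', hu, h⟩ := exists_lefschetz_bivariate (K := K) (a := c + 1 - 2 * e) (b := F)
      (i := i - e) (k := k) (by omega) hF (by omega) (α := j) (β := b) (by omega)
    have h' := congrArg (aeval ![rename Fin.castSucc l, X (Fin.last N)]) h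
    simp only [map_add, map_mul, map_pow, aeval_X, Matrix.cons_val_zero, Matrix.cons_val_one] at h'
    refine mem_lefschetzImage.2 ⟨aeval ![rename Fin.castSucc l, X (Fin.last N)] u
      * rename Fin.castSucc v, ?_, ?_⟩
    · have h1 : (aeval ![rename Fin.castSucc l, X (Fin.last N)] u :
          MvPolynomial (Fin (N + 1)) K).IsHomogeneous (1 * (i - e)) := by
        refine hu.aeval _ fun t => ?_
        fin_cases t
        · exact hl.rename_isHomogeneous
        · exact isHomogeneous_X K _
      convert h1.mul (hve.rename_isHomogeneous (f := Fin.castSucc)) using 1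
      omega
    · have : X (Fin.last N) ^ b * (rename Fin.castSucc l ^ j * rename Fin.castSucc v) -
          (rename Fin.castSucc l + X (Fin.last N)) ^ k *
            (aeval ![rename Fin.castSucc l, X (Fin.last N)] u * rename Fin.castSucc v) =
          aeval ![rename Fin.castSucc l, X (Fin.last N)] v' *
            (rename Fin.castSucc l ^ (c + 1 - 2 * e) * rename Fin.castSucc v) +
          aeval ![rename Fin.castSucc l, X (Fin.last N)] w' * rename Fin.castSucc v *
            X (Fin.last N) ^ F := by
        linear_combination (rename Fin.castSucc v) * h'
      rw [this]
      exact add_mem (I.mul_mem_left _ hvI) (I.mul_mem_left _ hFI)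
  -- If `e > i`, the degree `i + k` exceeds the socle degree of the bivariate algebra of the string.
  · refine mem_lefschetzImage_of_mem ?_
    by_cases hbF : F ≤ b
    · exact I.mul_mem_right _ (I.mem_of_dvd (pow_dvd_pow _ hbF) hFI)
    · refine I.mul_mem_left _ ?_
      rw [show j = (j - (c + 1 - 2 * e)) + (c + 1 - 2 * e) by omega, pow_add, mul_assoc]
      exact I.mul_mem_left _ hvI

theorem VanishesAbove.tensor {N : ℕ} {J : Ideal (MvPolynomial (Fin N) K)} {c F : ℕ}
    (hv : VanishesAbove J c) (hF : 0 < F) {I : Ideal (MvPolynomial (Fin (N + 1)) K)}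
    (hJI : ∀ p ∈ J, rename Fin.castSucc p ∈ I) (hFI : X (Fin.last N) ^ F ∈ I) :
    VanishesAbove I (c + F - 1) := by
  intro d hd
  refine homogeneousSubmodule_le_of_last fun b e q hbe hq => ?_
  by_cases hbF : F ≤ b
  · exact I.mul_mem_right _ (I.mem_of_dvd (pow_dvd_pow _ hbF) hFI)
  · exact I.mul_mem_left _ (hJI _ (hv e (by omega) hq))

theorem homogeneousComponent_mem_span {R : Type*} [CommRing R] {S : Set (MvPolynomial σ R)}
    (hS : ∀ f ∈ S, ∃ d, f.IsHomogeneous d) {p : MvPolynomial σ R} (hp : p ∈ Ideal.span S) (n : ℕ) :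
    homogeneousComponent n p ∈ Ideal.span S := by
  let := MvPolynomial.gradedAlgebra (σ := σ) (R := R)
  exact homogeneousComponent_mem_of_mem
    (Ideal.homogeneous_span (homogeneousSubmodule σ R) S fun f hf => hS f hf) hp n

/-- Semicontinuity: in a family of ideals `I_t` generated by forms with coefficients in `K[t]`,
surjectivity of multiplication by `g_t^k` at one value `t₀` implies surjectivity at all but finitely
many values of `t`: lifts over `K[t]` of the representations at `t₀` of the monomials form a square
matrix which is the identity at `t₀`, so that its determinant is not the zero polynomial. -/
theorem lefschetzImage_semicontinuous [Finite σ] {S : Set (MvPolynomial σ (Polynomial K))}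
    (hS : ∀ f ∈ S, ∃ d, f.IsHomogeneous d) {g : MvPolynomial σ (Polynomial K)}
    (hg : g.IsHomogeneous 1) (i k : ℕ) (t₀ : K)
    (h₀ : homogeneousSubmodule σ K (i + k) ≤ lefschetzImage
      (Ideal.span (map (Polynomial.evalRingHom t₀) '' S)) (map (Polynomial.evalRingHom t₀) g) i k) :
    {t : K | ¬ homogeneousSubmodule σ K (i + k) ≤ lefschetzImage
      (Ideal.span (map (Polynomial.evalRingHom t) '' S))
        (map (Polynomial.evalRingHom t) g) i k}.Finite := by
  classical
  let B : Type _ := {s : σ →₀ ℕ // s.degree = i + k}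
  have : Finite B := Finsupp.finite_of_degree_eq (i + k)
  have := Fintype.ofFinite B
  have hsurj : Function.Surjective (map (σ := σ) (Polynomial.evalRingHom t₀)) :=
    map_surjective _ fun x => ⟨Polynomial.C x, by simp⟩
  have hex (s : B) : ∃ u : MvPolynomial σ K, ∃ W ∈ Ideal.span S, u.IsHomogeneous i ∧
      monomial s.1 1 = map (Polynomial.evalRingHom t₀) g ^ k * u +
        map (Polynomial.evalRingHom t₀) W := by
    obtain ⟨u, hu, h⟩ := mem_lefschetzImage.1 (h₀ (isHomogeneous_monomial (1 : K) s.2))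
    rw [← Ideal.map_span, Ideal.mem_map_iff_of_surjective _ hsurj] at h
    obtain ⟨W, hW, h⟩ := h
    exact ⟨u, W, hW, hu, by rw [h]; ring⟩
  choose u W hW hu hm using hex
  let G (s : B) : MvPolynomial σ (Polynomial K) := g ^ k * map Polynomial.C (u s) + W s
  let M : Matrix B B (Polynomial K) := fun s s' => coeff s'.1 (G s)
  have hmap (t : K) (s : B) : map (Polynomial.evalRingHom t) (G s) =
      map (Polynomial.evalRingHom t) g ^ k * u s + map (Polynomial.evalRingHom t) (W s) := by
    simp only [G, map_add, map_mul, map_pow, map_map]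
    congr 2
    convert map_id (u s)
    ext x; simp
  have hM (t : K) (s s' : B) : (M.map (Polynomial.evalRingHom t)) s s' =
      coeff s'.1 (map (Polynomial.evalRingHom t) (G s)) := by
    rw [coeff_map]; rfl
  have hM0 : M.map (Polynomial.evalRingHom t₀) = 1 := by
    ext s s'
    rw [hM, hmap, ← hm, coeff_monomial, Matrix.one_apply]
    exact if_congr Subtype.ext_iff.symm rfl rfl
  have hdet : M.det ≠ 0 := by
    intro h
    have h1 := congrArg (Polynomial.evalRingHom t₀) h
    rw [RingHom.map_det, RingHom.mapMatrix_apply, hM0] at h1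
    simp at h1
  refine (M.det.finite_setOfPred_isRoot hdet).subset fun t ht => ?_
  by_contra hroot
  apply ht
  have hu' : IsUnit (M.map (Polynomial.evalRingHom t)).det := by
    rw [← RingHom.mapMatrix_apply, ← RingHom.map_det]
    exact isUnit_iff_ne_zero.2 hroot
  set L := lefschetzImage (Ideal.span (map (Polynomial.evalRingHom t) '' S))
        (map (Polynomial.evalRingHom t) g) i k
  have hrow (s : B) : ∑ s' : B, (M.map (Polynomial.evalRingHom t)) s s' • monomial s'.1 (1 : K)
      ∈ L := by
    have h1 : ∑ s' : B, (M.map (Polynomial.evalRingHom t)) s s' • monomial s'.1 (1 : K) =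
        homogeneousComponent (i + k) (map (Polynomial.evalRingHom t) (G s)) := by
      ext d
      rw [coeff_homogeneousComponent, coeff_sum]
      simp only [coeff_smul, coeff_monomial, hM]
      split_ifs with hd
      · rw [Finset.sum_eq_single ⟨d, hd⟩]
        · simp
        · intro b _ hb
          rw [if_neg fun h => hb (Subtype.ext h), smul_zero]
        · simp
      · refine Finset.sum_eq_zero fun b _ => ?_
        rw [if_neg, smul_zero]
        rintro rfl
        exact hd b.2
    rw [h1, hmap, map_add]
    refine add_mem (mem_lefschetzImage.2 ⟨u s, hu s, ?_⟩) (mem_lefschetzImage_of_mem ?_)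
    · rw [homogeneousComponent_eq_self, sub_self]
      · exact zero_mem _
      · rw [add_comm]
        exact (isHomogeneous_pow_of_linear (hg.map _) k).mul (hu s)
    · refine homogeneousComponent_mem_span ?_ ?_ _
      · rintro _ ⟨f, hf, rfl⟩
        obtain ⟨d, hd⟩ := hS f hf
        exact ⟨d, hd.map _⟩
      · rw [← Ideal.map_span]
        exact Ideal.mem_map_of_mem _ (hW s)
  have hmon (s : B) : monomial s.1 (1 : K) ∈ L := by
    have h2 : monomial s.1 (1 : K) = ∑ b : B, (M.map (Polynomial.evalRingHom t))⁻¹ s b •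
        ∑ s' : B, (M.map (Polynomial.evalRingHom t)) b s' • monomial s'.1 (1 : K) := by
      simp_rw [Finset.smul_sum, smul_smul]
      rw [Finset.sum_comm]
      simp_rw [← Finset.sum_smul, ← Matrix.mul_apply, Matrix.nonsing_inv_mul _ hu',
        Matrix.one_apply, ite_smul, one_smul, zero_smul]
      rw [Finset.sum_ite_eq, if_pos (Finset.mem_univ _)]
    rw [h2]
    exact sum_mem fun b _ => L.smul_mem _ (hrow b)
  intro p hp
  rw [p.as_sum]
  refine sum_mem fun s hs => ?_
  have h3 := hmon ⟨s, by
    by_contra hne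
    exact (mem_support_iff.1 hs) (hp.coeff_eq_zero hne)⟩
  have h4 := L.smul_mem (coeff s p) h3
  rwa [smul_monomial, smul_eq_mul, mul_one] at h4

end Lefschetz

/-! ### Regularity of symmetric polynomials in powers of the variables -/

section Regular

open MvPolynomial

variable {K : Type*} [Field K]

theorem homogeneousComponent_mul_left {σ : Type*} {f : MvPolynomial σ K} {d : ℕ}
    (hf : f.IsHomogeneous d) (q : MvPolynomial σ K) {n : ℕ} (h : d ≤ n) :
    homogeneousComponent n (f * q) = f * homogeneousComponent (n - d) q := by
  conv_lhs => rw [← sum_homogeneousComponent q, Finset.mul_sum, map_sum]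
  simp_rw [homogeneousComponent_of_mem (hf.mul (homogeneousComponent_isHomogeneous _ q))]
  by_cases hq : n - d ∈ Finset.range (q.totalDegree + 1)
  · rw [Finset.sum_eq_single_of_mem _ hq fun e _ he => if_neg (by omega), if_pos (by omega)]
  · rw [homogeneousComponent_eq_zero _ _ (by rw [Finset.mem_range] at hq; omega), mul_zero]
    exact Finset.sum_eq_zero fun e he => if_neg (by rintro rfl; exact hq (by simpa using he))

theorem homogeneousComponent_mul_left_of_lt {σ : Type*} {f : MvPolynomial σ K} {d : ℕ}
    (hf : f.IsHomogeneous d) (q : MvPolynomial σ K) {n : ℕ} (h : n < d) :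
    homogeneousComponent n (f * q) = 0 := by
  conv_lhs => rw [← sum_homogeneousComponent q, Finset.mul_sum, map_sum]
  refine Finset.sum_eq_zero fun e _ => ?_
  rw [homogeneousComponent_of_mem (hf.mul (homogeneousComponent_isHomogeneous _ q)),
    if_neg (by omega)]

@[simp] theorem killLast_X_last (m : ℕ) : killLast K m (X (Fin.last m)) = 0 := by
  simp [killLast]

@[simp] theorem killLast_X_castSucc (m : ℕ) (i : Fin m) :
    killLast K m (X (Fin.castSucc i)) = X i := by
  simp [killLast]

@[simp] theorem killLast_rename (m : ℕ) (p : MvPolynomial (Fin m) K) :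
    killLast K m (rename Fin.castSucc p) = p := by
  have : (killLast K m).comp (rename Fin.castSucc) = AlgHom.id K _ := by
    ext i; simp
  exact DFunLike.congr_fun this p

theorem killLast_surjective (m : ℕ) : Function.Surjective (killLast K m) :=
  fun p => ⟨rename Fin.castSucc p, killLast_rename m p⟩

theorem sub_rename_killLast_mem (m : ℕ) (p : MvPolynomial (Fin (m + 1)) K) :
    p - rename Fin.castSucc (killLast K m p) ∈ Ideal.span {X (Fin.last m)} := by
  rw [← Ideal.Quotient.eq]
  have : Ideal.Quotient.mkₐ K (Ideal.span {X (Fin.last m)}) =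
      (Ideal.Quotient.mkₐ K (Ideal.span {X (Fin.last m)})).comp
        ((rename Fin.castSucc).comp (killLast K m)) := by
    apply algHom_ext
    intro i
    refine Fin.lastCases ?_ (fun i => ?_) i
    · simp
    · simp
  exact DFunLike.congr_fun this p

theorem ker_killLast (m : ℕ) : RingHom.ker (killLast K m) = Ideal.span {X (Fin.last m)} := by
  apply le_antisymm
  · intro p hp
    have := sub_rename_killLast_mem m p
    rwa [(hp : killLast K m p = 0), map_zero, sub_zero] at this
  · rw [Ideal.span_le, Set.singleton_subset_iff]
    exact killLast_X_last m

theorem killLast_mem_map_iff {m : ℕ} {J : Ideal (MvPolynomial (Fin (m + 1)) K)}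
    {p : MvPolynomial (Fin (m + 1)) K} :
    killLast K m p ∈ J.map (killLast K m) ↔ p ∈ J ⊔ Ideal.span {X (Fin.last m)} := by
  have := Ideal.comap_map_of_surjective' (killLast K m) (killLast_surjective m) J
  rw [ker_killLast] at this
  rw [← this, Ideal.mem_comap]

theorem killLast_isHomogeneous {m d : ℕ} {p : MvPolynomial (Fin (m + 1)) K}
    (hp : p.IsHomogeneous d) : (killLast K m p).IsHomogeneous d := by
  rw [killLast, ← one_mul d]
  exact hp.aeval _ (fun i => by
    refine Fin.lastCases ?_ (fun i => ?_) i
    · simpa using isHomogeneous_zero _ _ _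
    · simpa using isHomogeneous_X K i)

theorem multiset_esymm_cons {R : Type*} [CommSemiring R] (a : R) (s : Multiset R) (j : ℕ) :
    (a ::ₘ s).esymm (j + 1) = s.esymm (j + 1) + a * s.esymm j := by
  simp only [Multiset.esymm, Multiset.powersetCard_cons, Multiset.map_add, Multiset.sum_add,
    Multiset.map_map, Function.comp_def, Multiset.prod_cons, Multiset.sum_map_mul_left]

variable (K) in
/-- The elementary symmetric polynomial `e_j(x_1^r, …, x_n^r)`. -/
def powEsymm (n r j : ℕ) : MvPolynomial (Fin n) K := expand r (esymm (Fin n) K j)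

@[simp] theorem powEsymm_zero (n r : ℕ) : powEsymm K n r 0 = 1 := by simp [powEsymm]

theorem powEsymm_self (n r : ℕ) : powEsymm K n r n = (∏ i, X i) ^ r := by
  have : Finset.powersetCard n (Finset.univ : Finset (Fin n)) = {Finset.univ} := by
    simpa using Finset.powersetCard_self (Finset.univ : Finset (Fin n))
  simp [powEsymm, esymm, this, Finset.prod_pow]

theorem powEsymm_succ (n r j : ℕ) : powEsymm K (n + 1) r (j + 1) =
    rename Fin.castSucc (powEsymm K n r (j + 1)) +
      X (Fin.last n) ^ r * rename Fin.castSucc (powEsymm K n r j) := by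
  have h : esymm (Fin (n + 1)) K (j + 1) = rename Fin.castSucc (esymm (Fin n) K (j + 1)) +
      X (Fin.last n) * rename Fin.castSucc (esymm (Fin n) K j) := by
    have h1 (i : ℕ) : rename Fin.castSucc (esymm (Fin n) K i) =
        (Finset.univ.val.map fun t : Fin n => (X t.castSucc : MvPolynomial _ K)).esymm i := by
      rw [← aeval_esymm_eq_multiset_esymm (Fin n) K]
      congr 1
      ext t
      simp
    rw [esymm_eq_multiset_esymm, h1, h1, Fin.univ_castSuccEmb, Finset.cons_val, Multiset.map_cons,
      Finset.map_val, Multiset.map_map, multiset_esymm_cons]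
    rfl
  rw [powEsymm, h, map_add, map_mul, expand_X, ← rename_expand, ← rename_expand]
  rfl

theorem rename_perm_powEsymm (n r j : ℕ) (e : Equiv.Perm (Fin n)) :
    rename e (powEsymm K n r j) = powEsymm K n r j := by
  rw [powEsymm, rename_expand, rename_esymm]

theorem powEsymm_isHomogeneous (n r j : ℕ) : (powEsymm K n r j).IsHomogeneous (r * j) := by
  rw [powEsymm, esymm, map_sum]
  refine IsHomogeneous.sum _ _ _ fun t ht => ?_
  rw [map_prod]
  have := IsHomogeneous.prod t (fun i => expand r (X i : MvPolynomial (Fin n) K)) (fun _ => r)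
    (fun i _ => by rw [expand_X]; exact isHomogeneous_X_pow i r)
  convert this using 1
  rw [Finset.sum_const, (Finset.mem_powersetCard.1 ht).2, smul_eq_mul, mul_comm]

theorem killLast_powEsymm_succ (n : ℕ) {r : ℕ} (hr : 0 < r) (j : ℕ) :
    killLast K n (powEsymm K (n + 1) r (j + 1)) = powEsymm K n r (j + 1) := by
  rw [powEsymm_succ]
  simp [hr.ne']

variable (K) in
/-- The ideal generated by `e_i(x_1^r, …, x_n^r)` for `1 ≤ i ≤ j`. -/
def esymmIdeal (n r j : ℕ) : Ideal (MvPolynomial (Fin n) K) :=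
  Ideal.span ((fun i => powEsymm K n r (i + 1)) '' Set.Iio j)

theorem powEsymm_mem_esymmIdeal {n r i j : ℕ} (h : i < j) :
    powEsymm K n r (i + 1) ∈ esymmIdeal K n r j :=
  Ideal.subset_span ⟨i, h, rfl⟩

theorem esymmIdeal_zero (n r : ℕ) : esymmIdeal K n r 0 = ⊥ := by
  rw [esymmIdeal, Ideal.span_eq_bot]
  rintro _ ⟨i, hi, -⟩
  exact absurd hi (Nat.not_lt_zero i)

theorem esymmIdeal_succ (n r j : ℕ) :
    esymmIdeal K n r (j + 1) = esymmIdeal K n r j ⊔ Ideal.span {powEsymm K n r (j + 1)} := by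
  rw [esymmIdeal, esymmIdeal, ← Ideal.span_union]
  congr 1
  have : Set.Iio (j + 1) = Set.Iio j ∪ {j} := by ext i; simp
  rw [this, Set.image_union, Set.image_singleton]

theorem map_killLast_esymmIdeal (n : ℕ) {r : ℕ} (hr : 0 < r) (j : ℕ) :
    (esymmIdeal K (n + 1) r j).map (killLast K n) = esymmIdeal K n r j := by
  rw [esymmIdeal, Ideal.map_span, ← Set.image_comp, esymmIdeal]
  congr 1
  refine Set.image_congr fun i _ => ?_
  exact killLast_powEsymm_succ n hr i

theorem map_rename_esymmIdeal (n r j : ℕ) (e : Equiv.Perm (Fin n)) :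
    (esymmIdeal K n r j).map (rename e : _ →ₐ[K] MvPolynomial (Fin n) K) = esymmIdeal K n r j := by
  rw [esymmIdeal, Ideal.map_span, ← Set.image_comp]
  congr 1
  exact Set.image_congr fun i _ => rename_perm_powEsymm n r _ e

theorem homogeneousComponent_mem_esymmIdeal {n r j : ℕ} {p : MvPolynomial (Fin n) K}
    (hp : p ∈ esymmIdeal K n r j) (d : ℕ) : homogeneousComponent d p ∈ esymmIdeal K n r j := by
  refine homogeneousComponent_mem_span ?_ hp d
  rintro _ ⟨i, -, rfl⟩
  exact ⟨_, powEsymm_isHomogeneous n r _⟩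

/-- `f` is a nonzerodivisor modulo the ideal `J`. -/
def RegularMod {R : Type*} [CommRing R] (J : Ideal R) (f : R) : Prop :=
  ∀ p, f * p ∈ J → p ∈ J

theorem RegularMod.mul {R : Type*} [CommRing R] {J : Ideal R} {f g : R} (hf : RegularMod J f)
    (hg : RegularMod J g) : RegularMod J (f * g) :=
  fun p hp => hg p (hf _ (by rwa [← mul_assoc]))

theorem RegularMod.pow {R : Type*} [CommRing R] {J : Ideal R} {f : R} (hf : RegularMod J f)
    (n : ℕ) : RegularMod J (f ^ n) := by
  induction n with
  | zero => intro p hp; simpa using hp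
  | succ n ih => rw [pow_succ]; exact ih.mul hf

theorem RegularMod.prod {R ι : Type*} [CommRing R] {J : Ideal R} {f : ι → R} {s : Finset ι}
    (hf : ∀ i ∈ s, RegularMod J (f i)) : RegularMod J (∏ i ∈ s, f i) := by
  classical
  induction s using Finset.induction_on with
  | empty => intro p hp; simpa using hp
  | insert a s ha ih =>
    rw [Finset.prod_insert ha]
    exact (hf a (Finset.mem_insert_self a s)).mul
      (ih fun i hi => hf i (Finset.mem_insert_of_mem hi))

/-- Krull intersection for a homogeneous ideal: in degree `d`, membership modulo `x_n^(d + 1)`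
suffices. -/
theorem mem_of_forall_mem_sup_pow {m : ℕ} {J : Ideal (MvPolynomial (Fin (m + 1)) K)}
    (hJ : ∀ p ∈ J, ∀ d, homogeneousComponent d p ∈ J) {p : MvPolynomial (Fin (m + 1)) K}
    (hp : ∀ k, p ∈ J ⊔ Ideal.span {X (Fin.last m) ^ k}) : p ∈ J := by
  rw [← sum_homogeneousComponent p]
  refine sum_mem fun d _ => ?_
  obtain ⟨a, ha, b, hb, rfl⟩ := Submodule.mem_sup.1 (hp (d + 1))
  obtain ⟨c, rfl⟩ := Ideal.mem_span_singleton.1 hb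
  rw [map_add, homogeneousComponent_mul_left_of_lt (isHomogeneous_X_pow _ _) _ (Nat.lt_succ_self d),
    add_zero]
  exact hJ a ha d

/-- A homogeneous nonzerodivisor modulo `(J, x_n)` is one modulo `J` if `x_n` is. -/
theorem RegularMod.of_killLast {m : ℕ} {J : Ideal (MvPolynomial (Fin (m + 1)) K)}
    (hJ : ∀ p ∈ J, ∀ d, homogeneousComponent d p ∈ J) (hx : RegularMod J (X (Fin.last m)))
    {f : MvPolynomial (Fin (m + 1)) K} (hf : RegularMod (J.map (killLast K m)) (killLast K m f)) :
    RegularMod J f := by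
  intro p hp
  refine mem_of_forall_mem_sup_pow hJ fun k => ?_
  induction k with
  | zero => simp
  | succ k ih =>
    obtain ⟨a, ha, b, hb, rfl⟩ := Submodule.mem_sup.1 ih
    obtain ⟨c, rfl⟩ := Ideal.mem_span_singleton.1 hb
    have h1 : f * c ∈ J := by
      apply hx.pow k
      have : X (Fin.last m) ^ k * (f * c) = f * (a + X (Fin.last m) ^ k * c) - f * a := by ring
      rw [this]
      exact sub_mem hp (J.mul_mem_left _ ha)
    have h2 := hf (killLast K m c) (by rw [← map_mul]; exact Ideal.mem_map_of_mem _ h1)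
    obtain ⟨a', ha', b', hb', rfl⟩ := Submodule.mem_sup.1 (killLast_mem_map_iff.1 h2)
    obtain ⟨c', rfl⟩ := Ideal.mem_span_singleton.1 hb'
    refine Submodule.mem_sup.2 ⟨a + X (Fin.last m) ^ k * a', add_mem ha (J.mul_mem_left _ ha'),
      X (Fin.last m) ^ (k + 1) * c', Ideal.mem_span_singleton.2 ⟨c', rfl⟩, by ring⟩

/-- If `x_n` is a nonzerodivisor modulo `J`, and `f` is one modulo `(J, x_n)`, then the two may be
exchanged: `x_n` is a nonzerodivisor modulo `(J, f)`. -/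
theorem RegularMod.X_last_sup {m : ℕ} {J : Ideal (MvPolynomial (Fin (m + 1)) K)}
    (hx : RegularMod J (X (Fin.last m)))
    {f : MvPolynomial (Fin (m + 1)) K} (hf : RegularMod (J.map (killLast K m)) (killLast K m f)) :
    RegularMod (J ⊔ Ideal.span {f}) (X (Fin.last m)) := by
  intro p hp
  obtain ⟨a, ha, b, hb, h⟩ := Submodule.mem_sup.1 hp
  obtain ⟨c, rfl⟩ := Ideal.mem_span_singleton.1 hb
  have h2 := hf (killLast K m c) (by
    rw [← map_mul, killLast_mem_map_iff, show f * c = -a + X (Fin.last m) * p by rw [← h]; ring]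
    exact add_mem (Ideal.mem_sup_left (neg_mem ha))
      (Ideal.mem_sup_right (Ideal.mul_mem_right _ _ (Ideal.mem_span_singleton_self _))))
  obtain ⟨a', ha', b', hb', rfl⟩ := Submodule.mem_sup.1 (killLast_mem_map_iff.1 h2)
  obtain ⟨c', rfl⟩ := Ideal.mem_span_singleton.1 hb'
  have h3 := hx (p - f * c') (by
    rw [show X (Fin.last m) * (p - f * c') = a + f * a' by linear_combination -h]
    exact add_mem ha (J.mul_mem_left _ ha'))
  exact Submodule.mem_sup.2 ⟨_, h3, f * c', Ideal.mem_span_singleton.2 ⟨c', rfl⟩, by ring⟩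

/-- The inductive step from `n` to `n + 1` variables: the reduction modulo the last variable of an
ideal `esymmIdeal` is the ideal of the same kind in one variable less. -/
theorem regularMod_X_esymmIdeal_of {n r : ℕ} (hr : 0 < r)
    (ih : ∀ j < n, RegularMod (esymmIdeal K n r j) (powEsymm K n r (j + 1))) {j : ℕ} (hj : j ≤ n) :
    RegularMod (esymmIdeal K (n + 1) r j) (X (Fin.last n)) := by
  induction j with
  | zero =>
    intro p hp
    rw [esymmIdeal_zero, Ideal.mem_bot] at hp ⊢
    exact (mul_eq_zero.1 hp).resolve_left (X_ne_zero _)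
  | succ j ihj =>
    rw [esymmIdeal_succ]
    refine (ihj (by omega)).X_last_sup ?_
    rw [map_killLast_esymmIdeal n hr, killLast_powEsymm_succ n hr]
    exact ih j (by omega)

theorem regularMod_X_of_last {n r j : ℕ}
    (h : RegularMod (esymmIdeal K (n + 1) r j) (X (Fin.last n)))
    (i : Fin (n + 1)) : RegularMod (esymmIdeal K (n + 1) r j) (X i) := by
  intro p hp
  let e := Equiv.swap i (Fin.last n)
  have h1 := Ideal.mem_map_of_mem (rename e : _ →ₐ[K] MvPolynomial (Fin (n + 1)) K) hp
  rw [map_rename_esymmIdeal, map_mul, rename_X, Equiv.swap_apply_left] at h1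
  have h2 := Ideal.mem_map_of_mem (rename e : _ →ₐ[K] MvPolynomial (Fin (n + 1)) K) (h _ h1)
  rw [map_rename_esymmIdeal, rename_rename] at h2
  have h3 : (e : Fin (n + 1) → Fin (n + 1)) ∘ e = id := by ext i; simp [e]
  rwa [h3, rename_id_apply] at h2

/-- The sequence `e_1(x_1^r, …, x_n^r), …, e_n(x_1^r, …, x_n^r)` is regular. The last step uses that
each variable, by symmetry, is a nonzerodivisor modulo the first `n - 1` terms. -/
theorem regularMod_powEsymm {n r j : ℕ} (hr : 0 < r) (hj : j < n) :
    RegularMod (esymmIdeal K n r j) (powEsymm K n r (j + 1)) := by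
  induction n generalizing j with
  | zero => omega
  | succ n ih =>
    have hx : ∀ j ≤ n, RegularMod (esymmIdeal K (n + 1) r j) (X (Fin.last n)) := fun j hj =>
      regularMod_X_esymmIdeal_of hr (fun _ h => ih h) hj
    rcases Nat.lt_succ_iff_lt_or_eq.1 hj with hj' | rfl
    · refine RegularMod.of_killLast (fun p hp d => homogeneousComponent_mem_esymmIdeal hp d)
        (hx j hj'.le) ?_
      rw [map_killLast_esymmIdeal n hr, killLast_powEsymm_succ n hr]
      exact ih hj'
    · rw [powEsymm_self]
      exact (RegularMod.prod fun i _ => regularMod_X_of_last (hx _ le_rfl) i).pow r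

theorem regularMod_X_esymmIdeal {n r j : ℕ} (hr : 0 < r) (hj : j ≤ n) (i : Fin (n + 1)) :
    RegularMod (esymmIdeal K (n + 1) r j) (X i) :=
  regularMod_X_of_last (regularMod_X_esymmIdeal_of hr (fun _ h => regularMod_powEsymm hr h) hj) i

end Regular

/-! ### The complete intersection -/

section Generators

open MvPolynomial

variable {K : Type*} [Field K]

theorem gen_of_lt {m r s : ℕ} {j : Fin (m + 1)} (hj : (j : ℕ) < m) :
    gen K m r s j = powEsymm K (m + 1) r (j + 1) := by
  rw [gen, if_pos hj, powEsymm]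

theorem gen_last (m r s : ℕ) : gen K m r s (Fin.last m) = (∏ i, X i) ^ s := by
  rw [← powEsymm_self, gen, if_neg (by simp), powEsymm]

theorem isHomogeneous_prod_X_pow (n s : ℕ) :
    ((∏ i, X i : MvPolynomial (Fin n) K) ^ s).IsHomogeneous (s * n) := by
  rw [← powEsymm_self]; exact powEsymm_isHomogeneous n s n

theorem ofList_take_gen {m r s i : ℕ} (hi : i ≤ m) :
    Ideal.ofList ((List.ofFn (gen K m r s)).take i) = esymmIdeal K (m + 1) r i := by
  rw [Ideal.ofList, esymmIdeal]
  congr 1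
  ext p
  simp only [Set.mem_ofPred_eq, Set.mem_image, Set.mem_Iio, List.mem_take_iff_getElem,
    List.getElem_ofFn, List.length_ofFn]
  constructor
  · rintro ⟨j, hj, rfl⟩
    have hj' : j < i := lt_of_lt_of_le hj (min_le_left _ _)
    exact ⟨j, hj', (gen_of_lt (j := ⟨j, by omega⟩) (by simp; omega)).symm⟩
  · rintro ⟨j, hj, rfl⟩
    exact ⟨j, by omega, gen_of_lt (j := ⟨j, by omega⟩) (by simp; omega)⟩

theorem ofList_gen (m r s : ℕ) : Ideal.ofList (List.ofFn (gen K m r s)) = genIdeal K m r s := by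
  rw [Ideal.ofList, genIdeal]
  congr 1
  ext p
  exact List.mem_ofFn' _ _

theorem genIdeal_eq (m r s : ℕ) :
    genIdeal K m r s = esymmIdeal K (m + 1) r m ⊔ Ideal.span {(∏ i, X i) ^ s} := by
  rw [genIdeal, esymmIdeal, ← Ideal.span_union]
  congr 1
  ext p
  simp only [Set.mem_range, Set.mem_union, Set.mem_image, Set.mem_Iio, Set.mem_singleton_iff]
  constructor
  · rintro ⟨j, rfl⟩
    refine Fin.lastCases (Or.inr (gen_last m r s)) (fun j => Or.inl ⟨j, j.2, ?_⟩) j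
    exact (gen_of_lt (j := j.castSucc) j.2).symm
  · rintro (⟨j, hj, rfl⟩ | rfl)
    · exact ⟨⟨j, by omega⟩, gen_of_lt (j := ⟨j, by omega⟩) hj⟩
    · exact ⟨Fin.last m, gen_last m r s⟩

theorem esymmIdeal_le_genIdeal (m r s : ℕ) : esymmIdeal K (m + 1) r m ≤ genIdeal K m r s := by
  rw [genIdeal_eq]; exact le_sup_left

theorem prod_X_pow_mem_genIdeal (m r s : ℕ) : (∏ i, X i) ^ s ∈ genIdeal K m r s := by
  rw [genIdeal_eq]; exact Ideal.mem_sup_right (Ideal.mem_span_singleton_self _)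

theorem gen_isHomogeneous (m r s : ℕ) (j : Fin (m + 1)) :
    ∃ d, (gen K m r s j).IsHomogeneous d := by
  refine Fin.lastCases ⟨s * (m + 1), ?_⟩ (fun j => ⟨r * (j + 1), ?_⟩) j
  · rw [gen_last]; exact isHomogeneous_prod_X_pow _ _
  · rw [gen_of_lt (by simp)]; exact powEsymm_isHomogeneous _ _ _

theorem homogeneousComponent_mem_genIdeal {m r s : ℕ} {p : MvPolynomial (Fin (m + 1)) K}
    (hp : p ∈ genIdeal K m r s) (d : ℕ) : homogeneousComponent d p ∈ genIdeal K m r s := by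
  refine homogeneousComponent_mem_span ?_ hp d
  rintro _ ⟨j, rfl⟩
  exact gen_isHomogeneous m r s j

/-- The reduced ideals are the ideals `I` for one variable less. -/
theorem reducedIdeal_succ (m : ℕ) {r s t : ℕ} (hr : 0 < r) :
    reducedIdeal K (m + 1) r s t = genIdeal K m r t := by
  rw [reducedIdeal, genIdeal_eq, esymmIdeal, ← Ideal.span_union]
  congr 2
  ext p
  simp only [Set.mem_ofPred_eq, Set.mem_image, Set.mem_Iio]
  constructor
  · rintro ⟨j, hj, rfl⟩
    exact ⟨j, by omega, by rw [gen_of_lt (by omega), killLast_powEsymm_succ _ hr]⟩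
  · rintro ⟨j, hj, rfl⟩
    refine ⟨⟨j, by omega⟩, by simp; omega, ?_⟩
    rw [gen_of_lt (by simp; omega), killLast_powEsymm_succ _ hr]

theorem regularMod_prod_X_pow {m r : ℕ} (hr : 0 < r) (s : ℕ) :
    RegularMod (esymmIdeal K (m + 1) r m) ((∏ i, X i) ^ s) :=
  (RegularMod.prod fun i _ => regularMod_X_esymmIdeal hr le_rfl i).pow s

theorem genIdeal_ne_top {m r s : ℕ} (hr : 0 < r) (hs : 0 < s) : genIdeal K m r s ≠ ⊤ := by
  have h : genIdeal K m r s ≤ RingHom.ker (constantCoeff (R := K) (σ := Fin (m + 1))) := by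
    rw [genIdeal_eq, sup_le_iff, esymmIdeal, Ideal.span_le, Ideal.span_le,
      Set.singleton_subset_iff]
    refine ⟨?_, ?_⟩
    · rintro _ ⟨i, -, rfl⟩
      rw [SetLike.mem_coe, RingHom.mem_ker, constantCoeff_eq]
      refine (powEsymm_isHomogeneous _ _ _).coeff_eq_zero ?_
      simp
      omega
    · rw [SetLike.mem_coe, RingHom.mem_ker, map_pow, map_prod]
      simp [hs.ne']
  intro htop
  have : (1 : MvPolynomial (Fin (m + 1)) K) ∈ genIdeal K m r s := by rw [htop]; trivial
  simpa using h this

theorem isRegular_gen {m r s : ℕ} (hr : 0 < r) (hs : 0 < s) :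
    RingTheory.Sequence.IsRegular (MvPolynomial (Fin (m + 1)) K) (List.ofFn (gen K m r s)) := by
  refine ⟨⟨fun i hi => ?_⟩, ?_⟩
  · rw [List.length_ofFn] at hi
    rw [isSMulRegular_quotient_iff_mem_of_smul_mem, smul_eq_mul, Ideal.mul_top,
      ofList_take_gen (by omega), List.getElem_ofFn]
    rcases Nat.lt_succ_iff_lt_or_eq.1 hi with h | rfl
    · rw [gen_of_lt (by simpa using h)]
      exact regularMod_powEsymm hr hi
    · exact (gen_last (K := K) i r s) ▸ regularMod_prod_X_pow hr s
  · rw [smul_eq_mul, Ideal.mul_top, ofList_gen]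
    exact (genIdeal_ne_top hr hs).symm

end Generators

/-! ### The Hilbert function of a complete intersection -/

section Hilbert

open MvPolynomial

variable {K : Type*} [Field K]

instance finite_quotientGrading {σ : Type*} [Finite σ] (J : Ideal (MvPolynomial σ K)) (k : ℕ) :
    Module.Finite K (quotientGrading J k) := by
  have : Module.Finite K (homogeneousSubmodule σ K k) :=
    Module.Finite.iff_fg.2 (homogeneousSubmodule_fg _ _ k)
  exact Module.Finite.map _ _

/-- The Hilbert series of `K[σ]/J`, for a homogeneous ideal `J`. -/
def hilbertSeries {σ : Type*} (J : Ideal (MvPolynomial σ K)) : PowerSeries ℤ :=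
  PowerSeries.mk fun k => (Module.finrank K (quotientGrading J k) : ℤ)

theorem finrank_map_add_finrank_inf_ker {V W : Type*} [AddCommGroup V] [Module K V]
    [AddCommGroup W] [Module K W] (P : Submodule K V) [Module.Finite K P] (q : V →ₗ[K] W) :
    Module.finrank K (P.map q) + Module.finrank K ↥(P ⊓ LinearMap.ker q) =
      Module.finrank K P := by
  have h := LinearMap.finrank_range_add_finrank_ker (q.domRestrict P)
  rw [LinearMap.range_domRestrict] at h
  rw [← h, LinearMap.ker_domRestrict, ← Submodule.map_comap_subtype,
    Submodule.finrank_map_subtype_eq]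

/-- The exact sequence `0 → (K[σ]/J)(-d) → K[σ]/J → K[σ]/(J, f) → 0` in terms of Hilbert series. -/
theorem hilbertSeries_sup {σ : Type*} [Finite σ] {J : Ideal (MvPolynomial σ K)}
    (hJ : ∀ p ∈ J, ∀ d, homogeneousComponent d p ∈ J) {f : MvPolynomial σ K} {d : ℕ}
    (hf : f.IsHomogeneous d) (hreg : RegularMod J f) :
    hilbertSeries (J ⊔ Ideal.span {f}) = hilbertSeries J * (1 - PowerSeries.X ^ d) := by
  ext k
  rw [mul_sub, mul_one, map_sub, PowerSeries.coeff_mul_X_pow']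
  simp only [hilbertSeries, PowerSeries.coeff_mk]
  let q : (MvPolynomial σ K ⧸ J) →ₗ[K] (MvPolynomial σ K ⧸ (J ⊔ Ideal.span {f})) :=
    (Ideal.Quotient.factorₐ K le_sup_left).toLinearMap
  have hq (p) : q (Ideal.Quotient.mk J p) = Ideal.Quotient.mk _ p := rfl
  have hmap : (quotientGrading J k).map q = quotientGrading (J ⊔ Ideal.span {f}) k := by
    rw [quotientGrading, ← Submodule.map_comp]
    rfl
  have hrank := finrank_map_add_finrank_inf_ker (quotientGrading J k) q
  rw [hmap] at hrank
  -- A form in `(J, f)` is congruent modulo `J` to a multiple of `f`.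
  have key : ∀ a ∈ quotientGrading J k ⊓ LinearMap.ker q, ∃ c,
      Ideal.Quotient.mk J (homogeneousComponent k (f * c)) = a := by
    rintro a ⟨⟨p, hp, rfl⟩, ha⟩
    have h1 : p ∈ J ⊔ Ideal.span {f} := Ideal.Quotient.eq_zero_iff_mem.1 ha
    obtain ⟨b, hb, c, hc, h⟩ := Submodule.mem_sup.1 h1
    obtain ⟨c, rfl⟩ := Ideal.mem_span_singleton.1 hc
    refine ⟨c, ?_⟩
    change _ = Ideal.Quotient.mk J p
    rw [Ideal.Quotient.eq, ← homogeneousComponent_eq_self hp, ← map_sub, ← h,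
      show f * c - (b + f * c) = -b by ring]
    exact hJ _ (neg_mem hb) k
  split_ifs with hdk
  · have hinj : Function.Injective (LinearMap.mulLeft K (Ideal.Quotient.mk J f)) := by
      rw [← LinearMap.ker_eq_bot, LinearMap.ker_eq_bot']
      intro a ha
      obtain ⟨p, rfl⟩ := Ideal.Quotient.mk_surjective a
      rw [LinearMap.mulLeft_apply, ← map_mul, Ideal.Quotient.eq_zero_iff_mem] at ha
      exact Ideal.Quotient.eq_zero_iff_mem.2 (hreg p ha)
    have hker : quotientGrading J k ⊓ LinearMap.ker q =
        (quotientGrading J (k - d)).map (LinearMap.mulLeft K (Ideal.Quotient.mk J f)) := by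
      apply le_antisymm
      · intro a ha
        obtain ⟨c, rfl⟩ := key a ha
        rw [homogeneousComponent_mul_left hf _ hdk, map_mul]
        exact ⟨_, ⟨_, homogeneousComponent_isHomogeneous _ c, rfl⟩, rfl⟩
      · rintro _ ⟨_, ⟨p, hp, rfl⟩, rfl⟩
        refine ⟨⟨f * p, ?_, (map_mul (Ideal.Quotient.mk J) f p)⟩, ?_⟩
        · have := hf.mul hp
          rwa [Nat.add_sub_cancel' hdk] at this
        · rw [SetLike.mem_coe, LinearMap.mem_ker]
          change Ideal.Quotient.mk _ (f * p) = 0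
          rw [Ideal.Quotient.eq_zero_iff_mem]
          exact Ideal.mem_sup_right (Ideal.mul_mem_right _ _ (Ideal.mem_span_singleton_self f))
    rw [hker, ← (Submodule.equivMapOfInjective _ hinj _).finrank_eq] at hrank
    omega
  · have hker : quotientGrading J k ⊓ LinearMap.ker q = ⊥ := by
      rw [eq_bot_iff]
      intro a ha
      obtain ⟨c, rfl⟩ := key a ha
      rw [homogeneousComponent_mul_left_of_lt hf _ (not_le.1 hdk), map_zero]
      exact zero_mem _
    rw [hker, finrank_bot] at hrank
    omega

theorem hilbertSeries_bot (m : ℕ) :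
    hilbertSeries (⊥ : Ideal (MvPolynomial (Fin (m + 1)) K)) =
      (PowerSeries.invOneSubPow ℤ (m + 1)).val := by
  rw [PowerSeries.invOneSubPow_val_succ_eq_mk_add_choose, hilbertSeries]
  congr 1
  ext k
  have hinj : Function.Injective
      (Ideal.Quotient.mkₐ K (⊥ : Ideal (MvPolynomial (Fin (m + 1)) K))).toLinearMap := by
    intro a b hab
    have := Ideal.Quotient.eq.1 hab
    exact sub_eq_zero.1 this
  rw [quotientGrading, ← (Submodule.equivMapOfInjective _ hinj _).finrank_eq,
    homogeneousSubmodule_eq_finsupp_supported,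
    (AddMonoidAlgebra.supportedEquivFinsupp _).finrank_eq]
  have hset : {d : Fin (m + 1) →₀ ℕ | d.degree = k} =
      ↑(Finset.finsuppAntidiag (Finset.univ : Finset (Fin (m + 1))) k) := by
    ext d
    simp [Finsupp.degree_eq_sum]
  rw [hset, Module.finrank_finsupp_self, ← Set.toFinset_card, Finset.toFinset_coe,
    Finset.card_finsuppAntidiag_nat_eq_choose, Finset.card_univ, Fintype.card_fin,
    show m + 1 + k - 1 = m + k by omega, Nat.choose_symm_add]

/-- `1 + X + ⋯ + X^(d-1)`. -/
def geomPoly (d : ℕ) : Polynomial ℤ := ∑ i ∈ Finset.range d, Polynomial.X ^ i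

theorem coeff_geomPoly (d n : ℕ) : (geomPoly d).coeff n = if n < d then 1 else 0 := by
  simp [geomPoly, Polynomial.coeff_X_pow]

theorem coe_geomPoly_mul (d : ℕ) :
    (geomPoly d : PowerSeries ℤ) * (1 - PowerSeries.X) = 1 - PowerSeries.X ^ d := by
  have h := geom_sum_mul_neg (Polynomial.X : Polynomial ℤ) d
  have h' := congrArg (Polynomial.coeToPowerSeries.ringHom (R := ℤ)) h
  simpa [geomPoly] using h'

/-- `p` is palindromic with respect to the degree `N`: its coefficients of `X^i` and `X^(N - i)` are
equal. The coefficients of `X^0` and `X^N` are allowed to vanish. -/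
def IsPalindromic (p : Polynomial ℤ) (N : ℕ) : Prop := p.natDegree ≤ N ∧ p.reflect N = p

theorem IsPalindromic.mul {p q : Polynomial ℤ} {M N : ℕ} (hp : IsPalindromic p M)
    (hq : IsPalindromic q N) : IsPalindromic (p * q) (M + N) :=
  ⟨Polynomial.natDegree_mul_le_of_le hp.1 hq.1,
    by rw [Polynomial.reflect_mul _ _ hp.1 hq.1, hp.2, hq.2]⟩

theorem IsPalindromic.prod {ι : Type*} (s : Finset ι) {p : ι → Polynomial ℤ} {N : ι → ℕ}
    (h : ∀ i ∈ s, IsPalindromic (p i) (N i)) :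
    IsPalindromic (∏ i ∈ s, p i) (∑ i ∈ s, N i) := by
  classical
  induction s using Finset.induction_on with
  | empty => simp [IsPalindromic]
  | insert a s ha ih =>
    rw [Finset.prod_insert ha, Finset.sum_insert ha]
    exact (h a (Finset.mem_insert_self a s)).mul
      (ih fun i hi => h i (Finset.mem_insert_of_mem hi))

theorem isPalindromic_geomPoly {d : ℕ} (hd : 0 < d) : IsPalindromic (geomPoly d) (d - 1) := by
  constructor
  · rw [Polynomial.natDegree_le_iff_coeff_eq_zero]
    intro n hn
    rw [coeff_geomPoly, if_neg (by omega)]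
  · ext n
    rw [Polynomial.coeff_reflect, coeff_geomPoly, coeff_geomPoly]
    by_cases hn : n ≤ d - 1
    · rw [Polynomial.revAt_le hn, if_pos (by omega), if_pos (by omega)]
    · rw [Polynomial.revAt_eq_self_of_lt (by omega)]

/-- The Hilbert series `∏ (1 + X + ⋯ + X^(d_i - 1))` of `A`, where the `d_i` are the degrees of the
polynomials `gen K m r s`. -/
def hilbertGen (m r s : ℕ) : Polynomial ℤ :=
  (∏ j ∈ Finset.range m, geomPoly (r * (j + 1))) * geomPoly (s * (m + 1))

/-- The socle degree `∑ (d_i - 1)`, where the `d_i` are the degrees of the polynomials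
`gen K m r s`. -/
def socleDegree (m r s : ℕ) : ℕ :=
  ∑ j ∈ Finset.range m, (r * (j + 1) - 1) + (s * (m + 1) - 1)

theorem isPalindromic_hilbertGen {m r s : ℕ} (hr : 0 < r) (hs : 0 < s) :
    IsPalindromic (hilbertGen m r s) (socleDegree m r s) :=
  (IsPalindromic.prod _ fun j _ => isPalindromic_geomPoly (by positivity)).mul
    (isPalindromic_geomPoly (by positivity))

theorem coeff_zero_hilbertGen {m r s : ℕ} (hr : 0 < r) (hs : 0 < s) :
    (hilbertGen m r s).coeff 0 = 1 := by
  rw [hilbertGen, Polynomial.mul_coeff_zero, Polynomial.coeff_zero_prod, coeff_geomPoly,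
    if_pos (by positivity), mul_one]
  refine Finset.prod_eq_one fun j _ => ?_
  rw [coeff_geomPoly, if_pos (by positivity)]

theorem hilbertSeries_esymmIdeal {m r j : ℕ} (hr : 0 < r) (hj : j ≤ m) :
    hilbertSeries (esymmIdeal K (m + 1) r j) =
      (PowerSeries.invOneSubPow ℤ (m + 1)).val *
        ∏ i ∈ Finset.range j, (1 - PowerSeries.X ^ (r * (i + 1))) := by
  induction j with
  | zero => rw [esymmIdeal_zero, hilbertSeries_bot, Finset.prod_range_zero, mul_one]
  | succ j ih =>
    rw [esymmIdeal_succ, hilbertSeries_sup (fun p hp d => homogeneousComponent_mem_esymmIdeal hp d)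
      (powEsymm_isHomogeneous _ _ _) (regularMod_powEsymm hr (by omega)), ih (by omega),
      Finset.prod_range_succ, mul_assoc]

theorem hilbertSeries_genIdeal {m r s : ℕ} (hr : 0 < r) :
    hilbertSeries (genIdeal K m r s) = hilbertGen m r s := by
  rw [genIdeal_eq, hilbertSeries_sup (fun p hp d => homogeneousComponent_mem_esymmIdeal hp d)
    (isHomogeneous_prod_X_pow _ _) (regularMod_prod_X_pow hr s), hilbertSeries_esymmIdeal hr le_rfl]
  simp_rw [← coe_geomPoly_mul, Finset.prod_mul_distrib, Finset.prod_const, Finset.card_range]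
  have h1 : (PowerSeries.invOneSubPow ℤ (m + 1)).val * (1 - PowerSeries.X) ^ (m + 1) = 1 := by
    rw [← PowerSeries.invOneSubPow_inv_eq_one_sub_pow]
    exact (PowerSeries.invOneSubPow ℤ (m + 1)).val_inv
  have h2 : (hilbertGen m r s : PowerSeries ℤ) =
      (∏ j ∈ Finset.range m, (geomPoly (r * (j + 1)) : PowerSeries ℤ)) *
        (geomPoly (s * (m + 1)) : PowerSeries ℤ) := by
    have := map_prod (Polynomial.coeToPowerSeries.ringHom (R := ℤ))
      (fun j => geomPoly (r * (j + 1))) (Finset.range m)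
    simp only [Polynomial.coeToPowerSeries.ringHom_apply] at this
    rw [hilbertGen, Polynomial.coe_mul, this]
  rw [h2]
  linear_combination (∏ j ∈ Finset.range m, (geomPoly (r * (j + 1)) : PowerSeries ℤ)) *
        (geomPoly (s * (m + 1)) : PowerSeries ℤ) * h1

theorem finrank_quotientGrading_genIdeal {m r s : ℕ} (hr : 0 < r) (k : ℕ) :
    (Module.finrank K (quotientGrading (genIdeal K m r s) k) : ℤ) = (hilbertGen m r s).coeff k := by
  have := congrArg (PowerSeries.coeff k) (hilbertSeries_genIdeal (K := K) (m := m) (s := s) hr)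
  simpa [hilbertSeries] using this

theorem finrank_quotientGrading_symm {m r s : ℕ} (hr : 0 < r) (hs : 0 < s) {i : ℕ}
    (hi : i ≤ socleDegree m r s) :
    Module.finrank K (quotientGrading (genIdeal K m r s) i) =
      Module.finrank K (quotientGrading (genIdeal K m r s) (socleDegree m r s - i)) := by
  have h := finrank_quotientGrading_genIdeal (K := K) (m := m) (s := s) hr
  have h2 := congrArg (fun p => p.coeff i) (isPalindromic_hilbertGen (m := m) hr hs).2
  simp only [Polynomial.coeff_reflect, Polynomial.revAt_le hi] at h2
  have h3 := h i
  have h4 := h (socleDegree m r s - i)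
  omega

theorem quotientGrading_socleDegree_ne_bot {m r s : ℕ} (hr : 0 < r) (hs : 0 < s) :
    quotientGrading (genIdeal K m r s) (socleDegree m r s) ≠ ⊥ := by
  intro h
  have h1 := finrank_quotientGrading_symm (K := K) (m := m) hr hs (Nat.zero_le _)
  rw [Nat.sub_zero, h, finrank_bot] at h1
  have h2 := finrank_quotientGrading_genIdeal (K := K) (m := m) (s := s) hr 0
  rw [h1, coeff_zero_hilbertGen hr hs] at h2
  norm_num at h2

theorem quotientGrading_eq_bot {m r s : ℕ} (hr : 0 < r) (hs : 0 < s) {k : ℕ}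
    (hk : socleDegree m r s < k) : quotientGrading (genIdeal K m r s) k = ⊥ := by
  have h := finrank_quotientGrading_genIdeal (K := K) (m := m) (s := s) hr k
  rw [Polynomial.coeff_eq_zero_of_natDegree_lt
    ((isPalindromic_hilbertGen (m := m) hr hs).1.trans_lt hk)] at h
  exact Submodule.finrank_eq_zero.1 (by exact_mod_cast h)

theorem vanishesAbove_genIdeal {m r s : ℕ} (hr : 0 < r) (hs : 0 < s) :
    VanishesAbove (genIdeal K m r s) (socleDegree m r s) := by
  intro d hd p hp
  have h : Ideal.Quotient.mk (genIdeal K m r s) p ∈ quotientGrading (genIdeal K m r s) d :=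
    ⟨p, hp, rfl⟩
  rw [quotientGrading_eq_bot hr hs hd] at h
  exact Ideal.Quotient.eq_zero_iff_mem.1 h

end Hilbert

/-! ### Inheritance of the Lefschetz property from the central simple modules -/

section Inheritance

open MvPolynomial

variable {K : Type*} [Field K]

theorem LefschetzOnto.semicontinuous {σ : Type*} [Finite σ]
    {S : Set (MvPolynomial σ (Polynomial K))}
    (hS : ∀ f ∈ S, ∃ d, f.IsHomogeneous d) {g : MvPolynomial σ (Polynomial K)}
    (hg : g.IsHomogeneous 1) (c : ℕ) (t₀ : K)
    (h₀ : LefschetzOnto (Ideal.span (map (Polynomial.evalRingHom t₀) '' S))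
      (map (Polynomial.evalRingHom t₀) g) c) :
    {t : K | ¬ LefschetzOnto (Ideal.span (map (Polynomial.evalRingHom t) '' S))
        (map (Polynomial.evalRingHom t) g) c}.Finite := by
  refine ((Finset.range (c + 1)).finite_toSet.biUnion (t := fun i => {t : K | 2 * i ≤ c ∧
    ¬ homogeneousSubmodule σ K (i + (c - 2 * i)) ≤ lefschetzImage
      (Ideal.span (map (Polynomial.evalRingHom t) '' S))
        (map (Polynomial.evalRingHom t) g) i (c - 2 * i)}) fun i _ => ?_).subset ?_
  · by_cases hi : 2 * i ≤ c
    · exact (lefschetzImage_semicontinuous hS hg i (c - 2 * i) t₀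
        (h₀ i _ (by omega))).subset fun t ht => ht.2
    · convert Set.finite_empty
      ext t
      simp [hi]
  · intro t ht
    simp only [LefschetzOnto, Set.mem_ofPred_eq, not_forall] at ht
    obtain ⟨i, k, hik, h⟩ := ht
    obtain rfl : k = c - 2 * i := by omega
    exact Set.mem_biUnion (x := i) (by simp; omega) ⟨by omega, h⟩

/-- Modulo `e_1(x^r), …, e_i(x^r)`, the elementary symmetric polynomials in the `r`-th powers of all
variables but the last one are powers of the last variable, up to sign. -/
theorem rename_powEsymm_sub_mem (n r : ℕ) {i j : ℕ} (hj : j ≤ i) :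
    rename Fin.castSucc (powEsymm K n r j) - (-X (Fin.last n) ^ r) ^ j ∈
      esymmIdeal K (n + 1) r i := by
  induction j with
  | zero => simp
  | succ j ih =>
    have h : rename Fin.castSucc (powEsymm K n r (j + 1)) - (-X (Fin.last n) ^ r) ^ (j + 1) =
        powEsymm K (n + 1) r (j + 1) - X (Fin.last n) ^ r *
          (rename Fin.castSucc (powEsymm K n r j) - (-X (Fin.last n) ^ r) ^ j) := by
      rw [powEsymm_succ]; ring
    rw [h]
    exact sub_mem (powEsymm_mem_esymmIdeal hj) (Ideal.mul_mem_left _ _ (ih (by omega)))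

theorem prod_X_succ (n : ℕ) : (∏ i, X i : MvPolynomial (Fin (n + 1)) K) =
    rename Fin.castSucc (∏ i, X i) * X (Fin.last n) := by
  rw [Fin.prod_univ_castSucc, map_prod]
  simp

theorem prod_X_pow_mul_X_last_pow_mem (m r s : ℕ) :
    rename Fin.castSucc ((∏ i, X i) ^ s) * X (Fin.last (m + 1)) ^ s ∈ genIdeal K (m + 1) r s := by
  rw [map_pow, ← mul_pow, ← prod_X_succ]
  exact prod_X_pow_mem_genIdeal _ _ _

theorem rename_prod_X_pow_sub_mem (m r : ℕ) :
    rename Fin.castSucc ((∏ i, X i) ^ r) - (-X (Fin.last (m + 1)) ^ r) ^ (m + 1) ∈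
      esymmIdeal K (m + 2) r (m + 1) := by
  rw [← powEsymm_self]
  exact rename_powEsymm_sub_mem (m + 1) r le_rfl

/-- If `P` is the product of all variables but the last one, `z`, then `P^r = ± z^(r (n - 1))` and
`P^s z^s = 0` in `A`, whence `z^(r (n - 1) + s) = 0`. -/
theorem X_last_pow_mem_genIdeal (m : ℕ) {r s : ℕ} (hsr : s ≤ r) :
    X (Fin.last (m + 1)) ^ (r * (m + 1) + s) ∈ genIdeal K (m + 1) r s := by
  have h1 := esymmIdeal_le_genIdeal (m + 1) r s (rename_prod_X_pow_sub_mem (K := K) m r)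
  have h2 := prod_X_pow_mul_X_last_pow_mem (K := K) m r s
  have h3 : (X (Fin.last (m + 1)) : MvPolynomial (Fin (m + 2)) K) ^ (r * (m + 1) + s) =
      (-1) ^ (m + 1) * (rename Fin.castSucc ((∏ i, X i) ^ (r - s)) *
        (rename Fin.castSucc ((∏ i, X i) ^ s) * X (Fin.last (m + 1)) ^ s) -
        X (Fin.last (m + 1)) ^ s * (rename Fin.castSucc ((∏ i, X i) ^ r) -
          (-X (Fin.last (m + 1)) ^ r) ^ (m + 1))) := by
    rw [← mul_assoc (rename _ _), ← map_mul, ← pow_add, Nat.sub_add_cancel hsr, pow_add, pow_mul,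
      neg_pow ((X (Fin.last (m + 1)) : MvPolynomial (Fin (m + 2)) K) ^ r) (m + 1)]
    have : ((-1 : MvPolynomial (Fin (m + 2)) K) ^ (m + 1)) ^ 2 = 1 := by
      rw [← pow_mul, mul_comm, pow_mul]; simp
    linear_combination -(X (Fin.last (m + 1)) ^ r) ^ (m + 1) * X (Fin.last (m + 1)) ^ s * this
  rw [h3]
  exact Ideal.mul_mem_left _ _ (sub_mem (Ideal.mul_mem_left _ _ h2) (Ideal.mul_mem_left _ _ h1))

theorem socleDegree_succ_first {m r s : ℕ} (hs : 0 < s) (hr : 0 < r) :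
    socleDegree (m + 1) r s = socleDegree m r s + (r * (m + 1) + s) - 1 := by
  have : 0 < s * (m + 1) := by positivity
  have : 0 < r * (m + 1) := by positivity
  rw [socleDegree, socleDegree, Finset.sum_range_succ, mul_add s (m + 1) 1]
  omega

/-- Shifted by `s (n - 1)`, the tensor product of the second central simple module with `K[z]/(z^s)`
has the same centre of symmetry as `A`. -/
theorem socleDegree_succ_second {m r s : ℕ} (hs : 0 < s) (hsr : s < r) :
    socleDegree (m + 1) r s = socleDegree m r (r - s) + s - 1 + 2 * (s * (m + 1)) := by
  have h1 : 0 < s * (m + 1) := by positivity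
  have h2 : s * (m + 1) < r * (m + 1) := by gcongr
  rw [socleDegree, socleDegree, Finset.sum_range_succ, mul_add s (m + 1) 1, Nat.sub_mul]
  omega

/-- Let `I` contain the initial forms, with respect to the filtration by powers of `z`, of the
relations of `A`, and let `P` be the `s`-th power of the product of the other variables. Then
`K[x', z]/I` is an extension of its quotient by `P` by the ideal generated by `P`. The former is a
quotient of `U₁ ⊗ K[z]/(z^(r (n - 1) + s))`, the latter of `U₂ ⊗ K[z]/(z^s)` with a shift of
degrees, where `U₁` and `U₂` stand for the algebras of the two central simple modules. Both are
centred around half the socle degree of `A`, so that the Lefschetz property passes to `K[x', z]/I`.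
-/
theorem LefschetzOnto.of_extension [CharZero K] {m r s : ℕ} (hs : 0 < s) (hsr : s < r)
    {l : MvPolynomial (Fin (m + 1)) K} (hl : l.IsHomogeneous 1)
    (h₁ : LefschetzOnto (genIdeal K m r s) l (socleDegree m r s))
    (h₂ : LefschetzOnto (genIdeal K m r (r - s)) l (socleDegree m r (r - s)))
    {I : Ideal (MvPolynomial (Fin (m + 2)) K)}
    (hI : ∀ p ∈ I, ∀ d, homogeneousComponent d p ∈ I)
    (he : ∀ j < m + 1, rename Fin.castSucc (powEsymm K (m + 1) r (j + 1)) ∈ I)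
    (hP : rename Fin.castSucc ((∏ i, X i) ^ s) * X (Fin.last (m + 1)) ^ s ∈ I)
    (hz : X (Fin.last (m + 1)) ^ (r * (m + 1) + s) ∈ I) :
    LefschetzOnto I (rename Fin.castSucc l + X (Fin.last (m + 1))) (socleDegree (m + 1) r s) := by
  set P : MvPolynomial (Fin (m + 2)) K := rename Fin.castSucc ((∏ i, X i) ^ s) with hPdef
  have hPhom : P.IsHomogeneous (s * (m + 1)) :=
    (isHomogeneous_prod_X_pow (m + 1) s).rename_isHomogeneous
  have hr : 0 < r := hs.trans hsr
  have hrs : 0 < r - s := Nat.sub_pos_of_lt hsr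
  have hgen (t : ℕ) (I' : Ideal (MvPolynomial (Fin (m + 2)) K)) (hI' : I ≤ I')
      (ht : rename Fin.castSucc ((∏ i, X i) ^ t) ∈ I') :
      ∀ p ∈ genIdeal K m r t, rename Fin.castSucc p ∈ I' := by
    have : genIdeal K m r t ≤ I'.comap
        (rename Fin.castSucc : _ →ₐ[K] MvPolynomial (Fin (m + 2)) K) := by
      rw [genIdeal_eq, sup_le_iff, esymmIdeal, Ideal.span_le, Ideal.span_le,
        Set.singleton_subset_iff]
      refine ⟨?_, ht⟩
      rintro _ ⟨j, hj, rfl⟩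
      exact hI' (he j (Nat.lt_succ_of_lt hj))
    exact this
  -- The quotient by `P`, where `P` is the `s`-th power of the product of the other variables.
  have q₁ : LefschetzOnto (I ⊔ Ideal.span {P}) (rename Fin.castSucc l + X (Fin.last (m + 1)))
      (socleDegree (m + 1) r s) := by
    rw [socleDegree_succ_first hs hr]
    exact h₁.tensor hl (vanishesAbove_genIdeal hr hs) (by positivity)
      (hgen s _ le_sup_left (Ideal.mem_sup_right (Ideal.mem_span_singleton_self P)))
      (Ideal.mem_sup_left hz)
  -- The ideal generated by `P`, which is the quotient by the annihilator of `P`.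
  have hmem {q} : q ∈ I.colon {P} ↔ P * q ∈ I := by
    rw [Submodule.mem_colon_singleton, smul_eq_mul, mul_comm]
  have hIc : I ≤ I.colon {P} := fun q hq => hmem.2 (I.mul_mem_left _ hq)
  have hPc : rename Fin.castSucc ((∏ i, X i) ^ (r - s)) ∈ I.colon {P} := by
    rw [hmem, hPdef, ← map_mul, ← pow_add, Nat.add_sub_cancel' hsr.le, ← powEsymm_self]
    exact he m (Nat.lt_succ_self m)
  have q₂ : LefschetzOnto (I.colon {P}) (rename Fin.castSucc l + X (Fin.last (m + 1)))
      (socleDegree m r (r - s) + s - 1) :=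
    h₂.tensor hl (vanishesAbove_genIdeal hr hrs) hs (hgen _ _ hIc hPc) (hmem.2 hP)
  have v₂ : VanishesAbove (I.colon {P}) (socleDegree m r (r - s) + s - 1) :=
    (vanishesAbove_genIdeal hr hrs).tensor hs (hgen _ _ hIc hPc) (hmem.2 hP)
  have hc := socleDegree_succ_second (m := m) hs hsr
  intro i k hik p hp
  have hghom : (rename Fin.castSucc l + X (Fin.last (m + 1)) :
      MvPolynomial (Fin (m + 2)) K).IsHomogeneous 1 :=
    hl.rename_isHomogeneous.add (isHomogeneous_X K _)
  obtain ⟨u, hu, h⟩ := mem_lefschetzImage.1 (q₁ i k hik hp)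
  set g := rename Fin.castSucc l + X (Fin.last (m + 1))
  obtain ⟨a, ha, b, hb, hab⟩ := Submodule.mem_sup.1 h
  obtain ⟨q, rfl⟩ := Ideal.mem_span_singleton.1 hb
  have hgu : (p - g ^ k * u).IsHomogeneous (i + k) := by
    refine hp.sub ?_
    rw [add_comm i k]
    exact (isHomogeneous_pow_of_linear hghom k).mul hu
  have hcomp := hI a ha (i + k)
  rw [show a = (p - g ^ k * u) - P * q by rw [← hab]; ring, map_sub,
    homogeneousComponent_eq_self hgu] at hcomp
  by_cases hD : s * (m + 1) ≤ i + k
  · rw [homogeneousComponent_mul_left hPhom q hD] at hcomp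
    set q' := homogeneousComponent (i + k - s * (m + 1)) q
    have hq' : q'.IsHomogeneous (i + k - s * (m + 1)) := homogeneousComponent_isHomogeneous _ _
    by_cases hi : s * (m + 1) ≤ i
    · obtain ⟨u', hu', h'⟩ := mem_lefschetzImage.1 (q₂ (i - s * (m + 1)) k (by omega) (x := q')
        (by rw [mem_homogeneousSubmodule]; convert hq' using 1; omega))
      refine mem_lefschetzImage.2 ⟨u + P * u', hu.add ?_, ?_⟩
      · have := hPhom.mul hu'
        rwa [Nat.add_sub_cancel' hi] at this
      · have h3 := add_mem hcomp (hmem.1 h')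
        convert h3 using 1
        ring
    · have h3 := hmem.1 (v₂ (i + k - s * (m + 1)) (by omega) hq')
      refine mem_lefschetzImage.2 ⟨u, hu, ?_⟩
      simpa using add_mem hcomp h3
  · rw [homogeneousComponent_mul_left_of_lt hPhom q (not_le.1 hD), sub_zero] at hcomp
    exact mem_lefschetzImage.2 ⟨u, hu, hcomp⟩

theorem map_eval_map_C {σ : Type*} (t : K) (p : MvPolynomial σ K) :
    map (Polynomial.evalRingHom t) (map Polynomial.C p) = p := by
  rw [map_map]
  convert map_id p
  ext x; simp

variable (K) in
/-- The substitution `x_n ↦ a x_n`. -/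
def scaleLast (n : ℕ) (a : K) :
    MvPolynomial (Fin (n + 1)) K →ₐ[K] MvPolynomial (Fin (n + 1)) K :=
  aeval (Fin.lastCases (C a * X (Fin.last n)) fun i => X i.castSucc)

@[simp] theorem scaleLast_X_last (n : ℕ) (a : K) :
    scaleLast K n a (X (Fin.last n)) = C a * X (Fin.last n) := by
  simp [scaleLast]

@[simp] theorem scaleLast_rename (n : ℕ) (a : K) (p : MvPolynomial (Fin n) K) :
    scaleLast K n a (rename Fin.castSucc p) = rename Fin.castSucc p := by
  have : (scaleLast K n a).comp (rename Fin.castSucc) = rename Fin.castSucc := by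
    ext i; simp [scaleLast]
  exact DFunLike.congr_fun this p

theorem scaleLast_scaleLast (n : ℕ) {a b : K} (hab : a * b = 1) (p : MvPolynomial (Fin (n + 1)) K) :
    scaleLast K n a (scaleLast K n b p) = p := by
  have : (scaleLast K n a).comp (scaleLast K n b) = AlgHom.id K _ := by
    apply algHom_ext
    intro i
    refine Fin.lastCases ?_ (fun i => ?_) i
    · simp only [AlgHom.comp_apply, scaleLast_X_last, map_mul, AlgHom.id_apply]
      rw [algHom_C, ← mul_assoc, algebraMap_eq, ← C_mul, mul_comm b a, hab, C_1, one_mul]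
    · simp [scaleLast]
  exact DFunLike.congr_fun this p

theorem scaleLast_isHomogeneous {n d : ℕ} (a : K) {p : MvPolynomial (Fin (n + 1)) K}
    (hp : p.IsHomogeneous d) : (scaleLast K n a p).IsHomogeneous d := by
  rw [scaleLast, ← one_mul d]
  refine hp.aeval _ (fun i => ?_)
  refine Fin.lastCases ?_ (fun i => ?_) i
  · simpa using isHomogeneous_C_mul_X a (Fin.last n)
  · simpa using isHomogeneous_X K i.castSucc

variable (K) in
/-- The relations of `A` after the substitution `x_n ↦ t x_n`, over `K[t]`, where those which become
divisible by a power of `t` are divided by it. At `t = 0` they become the relations of the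
associated graded algebra of `A` with respect to `x_n`. -/
def degeneration (m r s : ℕ) : Set (MvPolynomial (Fin (m + 2)) (Polynomial K)) :=
  (fun j => map Polynomial.C (rename Fin.castSucc (powEsymm K (m + 1) r (j + 1))) -
      (-(C Polynomial.X * X (Fin.last (m + 1))) ^ r) ^ (j + 1)) '' Set.Iio (m + 1) ∪
  {map Polynomial.C (rename Fin.castSucc ((∏ i, X i) ^ s) * X (Fin.last (m + 1)) ^ s),
    X (Fin.last (m + 1)) ^ (r * (m + 1) + s)}

theorem degeneration_isHomogeneous {m r s : ℕ} {f : MvPolynomial (Fin (m + 2)) (Polynomial K)}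
    (hf : f ∈ degeneration K m r s) : ∃ d, f.IsHomogeneous d := by
  rcases hf with ⟨j, -, rfl⟩ | rfl | rfl
  · refine ⟨r * (j + 1), ?_⟩
    refine IsHomogeneous.sub ((powEsymm_isHomogeneous _ _ _).rename_isHomogeneous.map _) ?_
    refine IsHomogeneous.pow (IsHomogeneous.neg ?_) _
    simpa using (isHomogeneous_C_mul_X (Polynomial.X : Polynomial K) (Fin.last (m + 1))).pow r
  · exact ⟨_, ((isHomogeneous_prod_X_pow _ _).rename_isHomogeneous.mul
      (isHomogeneous_X_pow _ _)).map _⟩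
  · exact ⟨_, isHomogeneous_X_pow _ _⟩

/-- The Lefschetz property is inherited from the two central simple modules. It holds for the
special fibre of the degeneration of `A`, hence, by semicontinuity, for some fibre at a nonzero
value, and such a fibre becomes `A` after rescaling `x_n`. -/
theorem LefschetzOnto.inherit [CharZero K] {m r s : ℕ} (hs : 0 < s) (hsr : s < r)
    {l : MvPolynomial (Fin (m + 1)) K} (hl : l.IsHomogeneous 1)
    (h₁ : LefschetzOnto (genIdeal K m r s) l (socleDegree m r s))
    (h₂ : LefschetzOnto (genIdeal K m r (r - s)) l (socleDegree m r (r - s))) :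
    ∃ g : MvPolynomial (Fin (m + 2)) K, g.IsHomogeneous 1 ∧
      LefschetzOnto (genIdeal K (m + 1) r s) g (socleDegree (m + 1) r s) := by
  have hr : 0 < r := hs.trans hsr
  set g₀ : MvPolynomial (Fin (m + 2)) K := rename Fin.castSucc l + X (Fin.last (m + 1)) with hg₀
  have hg₀hom : g₀.IsHomogeneous 1 := hl.rename_isHomogeneous.add (isHomogeneous_X K _)
  have hsp (t : K) {f} (hf : f ∈ degeneration K m r s) : map (Polynomial.evalRingHom t) f ∈
      Ideal.span (map (Polynomial.evalRingHom t) '' degeneration K m r s) :=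
    Ideal.subset_span ⟨f, hf, rfl⟩
  have hzero : LefschetzOnto
      (Ideal.span (map (Polynomial.evalRingHom (0 : K)) '' degeneration K m r s)) g₀
      (socleDegree (m + 1) r s) := by
    refine LefschetzOnto.of_extension hs hsr hl h₁ h₂ (fun p hp d => ?_) (fun j hj => ?_) ?_ ?_
    · refine homogeneousComponent_mem_span ?_ hp d
      rintro _ ⟨f, hf, rfl⟩
      obtain ⟨e, he⟩ := degeneration_isHomogeneous hf
      exact ⟨e, he.map _⟩
    · have := hsp 0 (Or.inl ⟨j, hj, rfl⟩)
      rw [map_sub, map_eval_map_C] at this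
      simpa [hr.ne'] using this
    · have := hsp 0 (Or.inr (Or.inl rfl))
      rwa [map_eval_map_C] at this
    · simpa using hsp 0 (Or.inr (Or.inr rfl))
  have hfin := LefschetzOnto.semicontinuous (g := map Polynomial.C g₀)
    (fun f hf => degeneration_isHomogeneous hf) (hg₀hom.map _) (socleDegree (m + 1) r s) 0
    (by rwa [map_eval_map_C])
  obtain ⟨t, ht⟩ := (hfin.union (Set.finite_singleton (0 : K))).infinite_compl.nonempty
  have ht0 : t ≠ 0 := fun h => ht (Or.inr h)
  have htL : LefschetzOnto
      (Ideal.span (map (Polynomial.evalRingHom t) '' degeneration K m r s)) g₀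
      (socleDegree (m + 1) r s) := by
    by_contra h
    refine ht (Or.inl ?_)
    rwa [Set.mem_ofPred_eq, map_eval_map_C]
  -- The substitution `x_n ↦ t⁻¹ x_n` turns the fibre at `t` into `A`.
  have hle : Ideal.span (map (Polynomial.evalRingHom t) '' degeneration K m r s) ≤
      (genIdeal K (m + 1) r s).comap (scaleLast K (m + 1) t⁻¹) := by
    rw [Ideal.span_le]
    rintro _ ⟨f, hf, rfl⟩
    rw [SetLike.mem_coe, Ideal.mem_comap]
    have hC : (C t⁻¹ : MvPolynomial (Fin (m + 2)) K) * C t = 1 := by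
      rw [← C_mul, inv_mul_cancel₀ ht0, C_1]
    rcases hf with ⟨j, hj, rfl⟩ | rfl | rfl
    · have h := esymmIdeal_le_genIdeal (m + 1) r s
        (rename_powEsymm_sub_mem (K := K) (m + 1) r (i := m + 1) (j := j + 1) hj)
      convert h using 1
      rw [map_sub, map_eval_map_C, map_sub, scaleLast_rename]
      congr 1
      simp only [map_pow, map_neg, map_mul, map_C, map_X, Polynomial.coe_evalRingHom,
        Polynomial.eval_X, scaleLast_X_last, algHom_C, algebraMap_eq]
      rw [← mul_assoc, mul_comm (C t), hC, one_mul]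
    · rw [map_eval_map_C, map_mul, scaleLast_rename, map_pow (scaleLast K (m + 1) t⁻¹),
        scaleLast_X_last, mul_pow, mul_left_comm]
      exact Ideal.mul_mem_left _ _ (prod_X_pow_mul_X_last_pow_mem _ _ _)
    · rw [map_pow, map_X, map_pow, scaleLast_X_last, mul_pow]
      exact Ideal.mul_mem_left _ _ (X_last_pow_mem_genIdeal _ hsr.le)
  refine ⟨scaleLast K (m + 1) t⁻¹ g₀, scaleLast_isHomogeneous _ hg₀hom, fun i k hik p hp => ?_⟩
  obtain ⟨u, hu, h⟩ := mem_lefschetzImage.1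
    (htL i k hik (scaleLast_isHomogeneous t ((mem_homogeneousSubmodule _ _).1 hp)))
  refine mem_lefschetzImage.2 ⟨scaleLast K (m + 1) t⁻¹ u, scaleLast_isHomogeneous _ hu, ?_⟩
  have h3 := hle h
  rwa [Ideal.mem_comap, map_sub, scaleLast_scaleLast _ (inv_mul_cancel₀ ht0), map_mul,
    map_pow] at h3

/-- On a line of linear forms, all but finitely many are Lefschetz elements if one of them is. -/
theorem LefschetzOnto.finite_pencil {σ ι : Type*} [Finite σ] {f : ι → MvPolynomial σ K}
    (hf : ∀ i, ∃ d, (f i).IsHomogeneous d) {l l' : MvPolynomial σ K} (hl : l.IsHomogeneous 1)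
    (hl' : l'.IsHomogeneous 1) {c : ℕ} {t₀ : K}
    (h : LefschetzOnto (Ideal.span (Set.range f)) (l + C t₀ * l') c) :
    {t : K | ¬ LefschetzOnto (Ideal.span (Set.range f)) (l + C t * l') c}.Finite := by
  have hGt (t : K) : map (Polynomial.evalRingHom t)
      (map Polynomial.C l + C Polynomial.X * map Polynomial.C l') = l + C t * l' := by
    rw [map_add, map_mul, map_eval_map_C, map_eval_map_C, map_C, Polynomial.coe_evalRingHom,
      Polynomial.eval_X]
  have hrange (t : K) : map (Polynomial.evalRingHom t) '' Set.range (map Polynomial.C ∘ f) =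
      Set.range f := by
    rw [← Set.range_comp]
    congr 1
    ext1 i
    exact map_eval_map_C t (f i)
  have := LefschetzOnto.semicontinuous (S := Set.range (map Polynomial.C ∘ f))
    (g := map Polynomial.C l + C Polynomial.X * map Polynomial.C l') (by
    rintro _ ⟨i, rfl⟩
    obtain ⟨d, hd⟩ := hf i
    exact ⟨d, hd.map _⟩) ((hl.map _).add ((hl'.map _).C_mul _)) c t₀ (by rwa [hrange, hGt])
  simpa only [hrange, hGt] using this

/-- Two quotients with Lefschetz elements have a common one, on the line joining the two. -/
theorem exists_common_lefschetz {σ ι κ : Type*} [Finite σ] [Infinite K]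
    {f : ι → MvPolynomial σ K} {f' : κ → MvPolynomial σ K}
    (hf : ∀ i, ∃ d, (f i).IsHomogeneous d) (hf' : ∀ i, ∃ d, (f' i).IsHomogeneous d)
    {l l' : MvPolynomial σ K} (hl : l.IsHomogeneous 1) (hl' : l'.IsHomogeneous 1) {c c' : ℕ}
    (h : LefschetzOnto (Ideal.span (Set.range f)) l c)
    (h' : LefschetzOnto (Ideal.span (Set.range f')) l' c') :
    ∃ g : MvPolynomial σ K, g.IsHomogeneous 1 ∧
      LefschetzOnto (Ideal.span (Set.range f)) g c ∧
      LefschetzOnto (Ideal.span (Set.range f')) g c' := by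
  have e₀ : l + C 0 * (l' - l) = l := by rw [C_0, zero_mul, add_zero]
  have e₁ : l + C 1 * (l' - l) = l' := by rw [C_1, one_mul, add_sub_cancel]
  obtain ⟨t, ht⟩ := ((LefschetzOnto.finite_pencil hf hl (hl'.sub hl) (e₀.symm ▸ h)).union
    (LefschetzOnto.finite_pencil hf' hl (hl'.sub hl) (e₁.symm ▸ h'))).infinite_compl.nonempty
  rw [Set.compl_union] at ht
  exact ⟨_, hl.add ((hl'.sub hl).C_mul t), not_not.1 ht.1, not_not.1 ht.2⟩

/-- The induction on the number of variables: the central simple modules for `(r, s)` are the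
algebras for `(r, s)` and `(r, r - s)` in one variable less, and these have a common Lefschetz
element. -/
theorem exists_lefschetzOnto [CharZero K] (m : ℕ) {r s : ℕ} (hs : 0 < s) (hsr : s < r) :
    ∃ g : MvPolynomial (Fin (m + 1)) K, g.IsHomogeneous 1 ∧
      LefschetzOnto (genIdeal K m r s) g (socleDegree m r s) := by
  induction m generalizing s with
  | zero =>
    -- In one variable, every form of degree `i + k` is divisible by `x^k`.
    refine ⟨X 0, isHomogeneous_X K 0, fun i k _ => ?_⟩
    refine homogeneousSubmodule_le_of_last fun b e q hbe hq => ?_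
    have hq' := hq
    rw [q.eq_C_of_isEmpty] at hq' ⊢
    by_cases h0 : coeff 0 q = 0
    · simp [h0]
    · have he : e = 0 := hq'.inj_right (isHomogeneous_C _ _) (by simpa using h0)
      refine mem_lefschetzImage.2 ⟨X 0 ^ i * C (coeff 0 q), ?_, ?_⟩
      · simpa using (isHomogeneous_X_pow (R := K) (0 : Fin 1) i).mul (isHomogeneous_C _ _)
      · have h1 : X (Fin.last 0) ^ b * rename Fin.castSucc (C (coeff 0 q)) -
            X 0 ^ k * (X 0 ^ i * C (coeff 0 q)) = (0 : MvPolynomial (Fin 1) K) := by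
          rw [rename_C, show b = k + i by omega, pow_add, mul_assoc]
          exact sub_self _
        rw [h1]
        exact zero_mem _
  | succ m ih =>
    obtain ⟨l₁, hl₁, h₁⟩ := ih hs hsr
    obtain ⟨l₂, hl₂, h₂⟩ := ih (s := r - s) (by omega) (by omega)
    obtain ⟨l, hl, h, h'⟩ := exists_common_lefschetz (gen_isHomogeneous m r s)
      (gen_isHomogeneous m r (r - s)) hl₁ hl₂ h₁ h₂
    exact LefschetzOnto.inherit hs hsr hl h h'

/-- Surjectivity is `exists_lefschetzOnto`; injectivity follows as the Hilbert function is
symmetric. -/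
theorem hasSLP_genIdeal [CharZero K] (m : ℕ) {r s : ℕ} (hs : 0 < s) (hsr : s < r) :
    HasSLP (quotientGrading (genIdeal K m r s)) := by
  have hr : 0 < r := hs.trans hsr
  obtain ⟨g, hg, h⟩ := exists_lefschetzOnto (K := K) m hs hsr
  set c := socleDegree m r s
  refine ⟨?_, c, quotientGrading_socleDegree_ne_bot hr hs,
    fun i hi => quotientGrading_eq_bot hr hs hi, Ideal.Quotient.mk _ g, ⟨g, hg, rfl⟩,
    fun i hi => ?_⟩
  · have htop : (⨆ i : Fin (c + 1), quotientGrading (genIdeal K m r s) i) = ⊤ := by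
      rw [eq_top_iff]
      rintro a -
      obtain ⟨p, rfl⟩ := Ideal.Quotient.mk_surjective a
      rw [← sum_homogeneousComponent p, map_sum]
      refine sum_mem fun d _ => ?_
      have hd : Ideal.Quotient.mk (genIdeal K m r s) (homogeneousComponent d p) ∈
          quotientGrading (genIdeal K m r s) d :=
        ⟨_, homogeneousComponent_isHomogeneous d p, rfl⟩
      by_cases hdc : d ≤ c
      · exact Submodule.mem_iSup_of_mem (⟨d, by omega⟩ : Fin (c + 1)) hd
      · rw [quotientGrading_eq_bot hr hs (not_le.1 hdc)] at hd
        rw [(Submodule.mem_bot K).1 hd]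
        exact zero_mem _
    rw [Module.finite_def, ← htop]
    exact Submodule.fg_iSup _ fun i => Module.Finite.iff_fg.1 inferInstance
  · have hmaps : ∀ a ∈ quotientGrading (genIdeal K m r s) i,
        LinearMap.mulLeft K (Ideal.Quotient.mk (genIdeal K m r s) g ^ (c - 2 * i)) a ∈
          quotientGrading (genIdeal K m r s) (c - i) := by
      rintro _ ⟨p, hp, rfl⟩
      refine ⟨g ^ (c - 2 * i) * p, ?_, ?_⟩
      · have := (isHomogeneous_pow_of_linear hg (c - 2 * i)).mul hp
        rw [SetLike.mem_coe, mem_homogeneousSubmodule]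
        convert this using 1
        omega
      · simp
    let φ := (LinearMap.mulLeft K (Ideal.Quotient.mk (genIdeal K m r s) g ^ (c - 2 * i))).restrict
      hmaps
    have hsurj : Function.Surjective φ := by
      rintro ⟨_, p, hp, rfl⟩
      obtain ⟨u, hu, h'⟩ := mem_lefschetzImage.1 (h i (c - 2 * i) (by omega) (x := p) (by
        rw [show i + (c - 2 * i) = c - i by omega]; exact hp))
      refine ⟨⟨_, u, hu, rfl⟩, Subtype.ext ?_⟩
      have := (Ideal.Quotient.eq.2 h').symm
      rwa [map_mul, map_pow] at this
    have hinj : Function.Injective φ :=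
      (LinearMap.injective_iff_surjective_of_finrank_eq_finrank
        (finrank_quotientGrading_symm hr hs (i := i) (by omega))).2 hsurj
    refine ⟨fun a ha => hmaps a ha, fun a ha b hb hab => ?_, fun b hb => ?_⟩
    · exact congrArg Subtype.val (@hinj ⟨a, ha⟩ ⟨b, hb⟩ (Subtype.ext hab))
    · obtain ⟨a, ha⟩ := hsurj ⟨b, hb⟩
      exact ⟨a, a.2, congrArg Subtype.val ha⟩

end Inheritance

/-! ### Jordan block sizes -/

section Jordan

variable {K V : Type*} [Field K] [AddCommGroup V] [Module K V]

/-- A basis of Jordan strings, with the blocks in any order and empty blocks allowed. -/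
theorem IsJordanBlockSizes.exists_of_basis {φ : Module.End K V} {ι : Type*} [Finite ι] {k : ι → ℕ}
    (b : Module.Basis (Σ i, Fin (k i)) K V)
    (hb : ∀ (i : ι) (j : Fin (k i)),
      φ (b ⟨i, j⟩) = if h : (j : ℕ) + 1 < k i then b ⟨i, ⟨(j : ℕ) + 1, h⟩⟩ else 0) :
    ∃ l, IsJordanBlockSizes φ l := by
  classical
  obtain ⟨n, ⟨e⟩⟩ := Finite.exists_equiv_fin {i // 0 < k i}
  let f : Fin n → ℕᵒᵈ := fun i => OrderDual.toDual (k (e.symm i))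
  let ε : Fin n → ι := fun i => (e.symm (Tuple.sort f i) : ι)
  have hanti : ∀ i j : Fin n, i ≤ j → k (ε j) ≤ k (ε i) := fun i j h => Tuple.monotone_sort f h
  have hpos (i : Fin n) : 0 < k (ε i) := (e.symm (Tuple.sort f i)).2
  let l := List.ofFn fun i => k (ε i)
  have hl : l.length = n := List.length_ofFn
  let ε' : Fin l.length → ι := fun i => ε (Fin.cast hl i)
  have hget (i : Fin l.length) : l.get i = k (ε' i) := List.get_ofFn _ i
  let F : (Σ i : Fin l.length, Fin (l.get i)) → Σ i, Fin (k i) :=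
    fun x => ⟨ε' x.1, Fin.cast (hget x.1) x.2⟩
  have hF : Function.Bijective F := by
    constructor
    · rintro ⟨i, j⟩ ⟨i', j'⟩ h
      have h1 : ε' i = ε' i' := congrArg Sigma.fst h
      have h2 : i = i' := by
        have := (Tuple.sort f).injective (e.symm.injective (Subtype.ext h1))
        simpa using this
      subst h2
      have h3 := eq_of_heq (Sigma.mk.inj h).2
      have h4 : j = j' := by simpa using h3
      rw [h4]
    · rintro ⟨i, j⟩
      obtain ⟨t, ht⟩ := (Tuple.sort f).surjective (e ⟨i, by have := j.2; omega⟩)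
      have h1 : ε' (Fin.cast hl.symm t) = i := by
        simp [ε', ε, ht]
      subst h1
      exact ⟨⟨Fin.cast hl.symm t, Fin.cast (hget _).symm j⟩, rfl⟩
  refine ⟨l, ⟨?_, ?_, b.reindex (Equiv.ofBijective F hF).symm, ?_⟩⟩
  · rw [List.pairwise_ofFn]
    exact fun i j hij => hanti i j hij.le
  · intro x hx
    obtain ⟨i, rfl⟩ := (List.mem_ofFn' _ _).1 hx
    exact hpos i
  · intro i j
    simp only [Module.Basis.reindex_apply, Equiv.symm_symm, Equiv.ofBijective_apply, F]
    rw [hb]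
    simp only [Fin.val_cast, hget]
    rfl

open Polynomial in
/-- The existence of the Jordan normal form of a nilpotent endomorphism, from the structure of
torsion modules over `K[X]`. -/
theorem exists_isJordanBlockSizes [Module.Finite K V] {φ : Module.End K V} (hφ : IsNilpotent φ) :
    ∃ l, IsJordanBlockSizes φ l := by
  obtain ⟨n, hn⟩ := hφ
  have htors : Module.IsTorsion' (Module.AEval' φ) (Submonoid.powers (X : K[X])) := by
    rw [Submodule.isTorsion'_powers_iff]
    intro x
    refine ⟨n, ?_⟩
    obtain ⟨v, rfl⟩ := (Module.AEval'.of φ).surjective x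
    rw [Module.AEval'.X_pow_smul_of, hn, zero_smul, map_zero]
  obtain ⟨d, k, ⟨e⟩⟩ := Module.torsion_by_prime_power_decomposition (irreducible_X (R := K)) htors
  let B (i : Fin d) : Module.Basis (Fin (k i)) K (K[X] ⧸ Submodule.span K[X] {(X : K[X]) ^ k i}) :=
    (AdjoinRoot.powerBasis' (monic_X_pow (R := K) (k i))).basis.reindex
      (finCongr (natDegree_X_pow (k i)))
  have hB (i : Fin d) (j : Fin (k i)) : B i j = Submodule.Quotient.mk (X ^ (j : ℕ)) := by
    have h := (AdjoinRoot.powerBasis' (monic_X_pow (R := K) (k i))).basis_eq_pow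
      ((finCongr (natDegree_X_pow (k i))).symm j)
    rw [AdjoinRoot.powerBasis'_gen] at h
    exact (Module.Basis.reindex_apply (M := AdjoinRoot ((X : K[X]) ^ k i)) _ _ _).trans h
  let E : V ≃ₗ[K] (∀ i, K[X] ⧸ Submodule.span K[X] {(X : K[X]) ^ k i}) :=
    ((Module.AEval'.of φ).trans (e.restrictScalars K)).trans
      ((DirectSum.linearEquivFunOnFintype K[X] (Fin d) _).restrictScalars K)
  have hE (v : V) : E (φ v) = (X : K[X]) • E v := by
    simp only [E, LinearEquiv.trans_apply, LinearEquiv.restrictScalars_apply]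
    rw [← Module.AEval'.X_smul_of, map_smul, map_smul]
  let b := (Pi.basis B).map E.symm
  have hbE (i : Fin d) (j : Fin (k i)) : E (b ⟨i, j⟩) =
      Pi.single i (Submodule.Quotient.mk (X ^ (j : ℕ))) := by
    simp [b, Pi.basis_apply, hB]
  refine IsJordanBlockSizes.exists_of_basis b fun i j => ?_
  apply E.injective
  rw [hE, hbE, ← Pi.single_smul, ← Submodule.Quotient.mk_smul, smul_eq_mul, ← pow_succ']
  split_ifs with h
  · rw [hbE]
  · rw [map_zero, Pi.single_eq_zero_iff, Submodule.Quotient.mk_eq_zero]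
    exact Ideal.mem_span_singleton.2 (pow_dvd_pow _ (by omega))

variable {A : Type*} [CommRing A] [Algebra K A]

theorem mem_colonAdd {z a : A} {k : ℕ} :
    a ∈ colonAdd z k ↔ ∃ c, z ^ k * (a - z * c) = 0 := by
  rw [colonAdd, Submodule.mem_sup]
  constructor
  · rintro ⟨x, hx, y, hy, rfl⟩
    obtain ⟨c, rfl⟩ := Ideal.mem_span_singleton.1 hy
    rw [Submodule.mem_colon_singleton, Submodule.mem_bot, smul_eq_mul] at hx
    exact ⟨c, by rw [add_sub_cancel_right, mul_comm, hx]⟩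
  · rintro ⟨c, hc⟩
    refine ⟨a - z * c, ?_, z * c, Ideal.mem_span_singleton.2 ⟨c, rfl⟩, by ring⟩
    rw [Submodule.mem_colon_singleton, Submodule.mem_bot, smul_eq_mul, mul_comm, hc]

/-- The block sizes are the exponents at which the filtration `(0 : z^k) + (z)` jumps. -/
theorem IsJordanBlockSizes.mem_iff {z : A} {l : List ℕ}
    (hl : IsJordanBlockSizes (LinearMap.mulLeft K z) l) (k : ℕ) :
    k + 1 ∈ l ↔ ¬ colonAdd z (k + 1) ≤ colonAdd z k := by
  obtain ⟨b, hb⟩ := hl.exists_basis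
  let β (i : Fin l.length) (j : ℕ) : A := if h : j < l.get i then b ⟨i, j, h⟩ else 0
  have hβ (i) (j : Fin (l.get i)) : b ⟨i, j⟩ = β i j := by simp [β]
  have hβ0 (i) (j : ℕ) (h : l.get i ≤ j) : β i j = 0 := dif_neg (by omega)
  have hz (i) (j : ℕ) : z * β i j = β i (j + 1) := by
    by_cases h : j < l.get i
    · have := hb i ⟨j, h⟩
      rw [LinearMap.mulLeft_apply, hβ] at this
      exact this
    · rw [hβ0 i j (by omega), hβ0 i (j + 1) (by omega), mul_zero]
  have hzn (i) (j n : ℕ) : z ^ n * β i j = β i (j + n) := by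
    induction n with
    | zero => simp
    | succ n ih => rw [pow_succ', mul_assoc, ih, hz]; rfl
  -- The coordinates of `z^n a` are those of `a`, shifted.
  have hcoord (n : ℕ) (a : A) (i) (j : ℕ) (h : j + n < l.get i) :
      b.repr (z ^ n * a) ⟨i, j + n, h⟩ = b.repr a ⟨i, j, by omega⟩ := by
    have : (b.coord ⟨i, j + n, h⟩) ∘ₗ (LinearMap.mulLeft K (z ^ n)) =
        b.coord ⟨i, j, by omega⟩ := by
      refine b.ext ?_
      rintro ⟨i', j'⟩
      rw [LinearMap.comp_apply, LinearMap.mulLeft_apply, hβ, hzn, ← hβ]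
      simp only [β, Module.Basis.coord_apply]
      by_cases hj : (j' : ℕ) + n < l.get i'
      · rw [dif_pos hj, Module.Basis.repr_self, Module.Basis.repr_self]
        by_cases hi : i' = i
        · subst hi
          by_cases hjj : (j' : ℕ) = j
          · subst hjj
            rw [Finsupp.single_eq_same, Finsupp.single_eq_same]
          · rw [Finsupp.single_eq_of_ne, Finsupp.single_eq_of_ne]
            · intro h'
              have := eq_of_heq (Sigma.mk.inj h').2
              exact hjj (congrArg Fin.val this).symm
            · intro h'
              have := congrArg Fin.val (eq_of_heq (Sigma.mk.inj h').2)
              simp at this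
              omega
        · rw [Finsupp.single_eq_of_ne, Finsupp.single_eq_of_ne]
          · exact fun h' => hi (congrArg Sigma.fst h').symm
          · exact fun h' => hi (congrArg Sigma.fst h').symm
      · rw [dif_neg hj, map_zero, Module.Basis.repr_self, Finsupp.single_eq_of_ne]
        · rfl
        · intro h'
          obtain rfl : i = i' := congrArg Sigma.fst h'
          have := congrArg Fin.val (eq_of_heq (Sigma.mk.inj h').2)
          simp at this
          omega
    exact LinearMap.congr_fun this a
  have hcoord0 (n : ℕ) (a : A) (i) (j : ℕ) (hj : j < l.get i) (h : j < n) :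
      b.repr (z ^ n * a) ⟨i, j, hj⟩ = 0 := by
    have : (b.coord ⟨i, j, hj⟩) ∘ₗ (LinearMap.mulLeft K (z ^ n)) = 0 := by
      refine b.ext ?_
      rintro ⟨i', j'⟩
      rw [LinearMap.comp_apply, LinearMap.mulLeft_apply, hβ, hzn, LinearMap.zero_apply]
      simp only [β, Module.Basis.coord_apply]
      by_cases hj' : (j' : ℕ) + n < l.get i'
      · rw [dif_pos hj', Module.Basis.repr_self, Finsupp.single_eq_of_ne]
        intro h'
        obtain rfl : i = i' := congrArg Sigma.fst h'
        have := congrArg Fin.val (eq_of_heq (Sigma.mk.inj h').2)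
        simp at this
        omega
      · rw [dif_neg hj', map_zero]
        rfl
    exact LinearMap.congr_fun this a
  constructor
  · intro hk hle
    obtain ⟨i, hi⟩ := List.mem_iff_get.1 hk
    have h1 : β i 0 ∈ colonAdd z (k + 1) :=
      mem_colonAdd.2 ⟨0, by rw [mul_zero, sub_zero, hzn, hβ0]; omega⟩
    obtain ⟨c, hc⟩ := mem_colonAdd.1 (hle h1)
    have h2 : z ^ k * β i 0 = z ^ (k + 1) * c := by
      rw [pow_succ]; linear_combination hc
    have h3 : k < l.get i := by omega
    have h4 := hcoord0 (k + 1) c i k h3 (Nat.lt_succ_self k)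
    rw [← h2, hzn, show β i (0 + k) = b ⟨i, k, h3⟩ by rw [zero_add, hβ],
      Module.Basis.repr_self, Finsupp.single_eq_same] at h4
    exact one_ne_zero h4
  · intro h
    by_contra hk
    apply h
    intro a ha
    obtain ⟨c, hc⟩ := mem_colonAdd.1 ha
    have hsub : a - z * c ∈ colonAdd z k := by
      rw [← b.sum_repr (a - z * c)]
      refine sum_mem ?_
      rintro ⟨i, j⟩ -
      rw [Algebra.smul_def]
      by_cases hj : (j : ℕ) = 0
      · by_cases h0 : b.repr (a - z * c) ⟨i, j⟩ = 0
        · rw [h0, map_zero, zero_mul]; exact zero_mem _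
        · refine Ideal.mul_mem_left _ _ (mem_colonAdd.2 ⟨0, ?_⟩)
          rw [mul_zero, sub_zero, hβ, hzn, hβ0]
          have hlt : ¬ k + 1 < l.get i := by
            intro hlt
            have h5 := hcoord (k + 1) (a - z * c) i 0 (by omega)
            rw [hc, map_zero] at h5
            apply h0
            have h6 : (⟨0, by omega⟩ : Fin (l.get i)) = j := Fin.ext hj.symm
            rw [h6] at h5
            exact h5.symm
          have hne : l.get i ≠ k + 1 := fun he => hk (he ▸ List.get_mem l i)
          omega
      · refine Ideal.mul_mem_left _ _ (mem_colonAdd.2 ⟨β i (j - 1), ?_⟩)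
        rw [hz, hβ, Nat.sub_add_cancel (by omega), sub_self, mul_zero]
    have := add_mem hsub (show z * c ∈ colonAdd z k from
      Ideal.mem_sup_right (Ideal.mem_span_singleton.2 ⟨c, rfl⟩))
    simpa using this

theorem IsJordanBlockSizes.dedup_eq {z : A} {l : List ℕ}
    (hl : IsJordanBlockSizes (LinearMap.mulLeft K z) l) {s F : ℕ} (hs : 0 < s) (hsF : s < F)
    (h : ∀ k, ¬ colonAdd z (k + 1) ≤ colonAdd z k ↔ k + 1 = F ∨ k + 1 = s) :
    l.dedup = [F, s] := by
  have hmem (x : ℕ) : x ∈ l.dedup ↔ x ∈ [F, s] := by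
    rw [List.mem_dedup]
    rcases x with _ | k
    · simp only [List.mem_cons, List.not_mem_nil, or_false]
      exact ⟨fun h0 => absurd (hl.pos 0 h0) (lt_irrefl 0), by omega⟩
    · rw [hl.mem_iff, h]
      simp
  have hperm : l.dedup.Perm [F, s] :=
    (List.perm_ext_iff_of_nodup (List.nodup_dedup l) (by simp; omega)).2 hmem
  exact hperm.eq_of_pairwise' (hl.decreasing.sublist (List.dedup_sublist l)) (by simp; omega)

end Jordan

/-! ### The ideals `(0 : z^k) + (z)` -/

section Colon

open MvPolynomial

variable {K : Type*} [Field K] {m r s : ℕ}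

theorem esymmIdeal_top_eq (m r : ℕ) : esymmIdeal K (m + 1) r (m + 1) = genIdeal K m r r := by
  rw [esymmIdeal_succ, powEsymm_self, genIdeal_eq]

theorem mem_genIdeal_iff {p : MvPolynomial (Fin (m + 1)) K} :
    p ∈ genIdeal K m r s ↔ ∃ c, p - (∏ i, X i) ^ s * c ∈ esymmIdeal K (m + 1) r m := by
  rw [genIdeal_eq, Submodule.mem_sup]
  constructor
  · rintro ⟨x, hx, y, hy, rfl⟩
    obtain ⟨c, rfl⟩ := Ideal.mem_span_singleton.1 hy
    exact ⟨c, by simpa using hx⟩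
  · rintro ⟨c, hc⟩
    exact ⟨_, hc, _, Ideal.mem_span_singleton.2 ⟨c, rfl⟩, by ring⟩

theorem genIdeal_le {t : ℕ} (h : t ≤ s) : genIdeal K m r s ≤ genIdeal K m r t := by
  rw [genIdeal_eq, genIdeal_eq]
  exact sup_le_sup le_rfl (Ideal.span_singleton_le_span_singleton.2 (pow_dvd_pow _ h))

/-- The colon ideal of the `s`-th power of the product of the variables. -/
theorem prod_X_pow_mul_mem_iff (hsr : s < r) {q : MvPolynomial (Fin (m + 1)) K} :
    (∏ i, X i) ^ s * q ∈ genIdeal K m r r ↔ q ∈ genIdeal K m r (r - s) := by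
  have hr : 0 < r := by omega
  have hpow : (∏ i, X i : MvPolynomial (Fin (m + 1)) K) ^ r =
      (∏ i, X i) ^ s * (∏ i, X i) ^ (r - s) := by
    rw [← pow_add, Nat.add_sub_cancel' hsr.le]
  rw [mem_genIdeal_iff, mem_genIdeal_iff]
  constructor
  · rintro ⟨c, hc⟩
    refine ⟨c, regularMod_prod_X_pow hr s _ ?_⟩
    rwa [hpow, mul_assoc, ← mul_sub] at hc
  · rintro ⟨c, hc⟩
    refine ⟨c, ?_⟩
    rw [hpow, mul_assoc, ← mul_sub]
    exact Ideal.mul_mem_left _ _ hc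

/-- Together with `killLast_mem_of_mem_esymmIdeal`: modulo `z`, the relations `f_1, …, f_{n-1}`
become the ideal of all the elementary symmetric polynomials in the `r`-th powers of the other
variables. -/
theorem exists_sub_X_last_mul_mem (hr : 0 < r) {p : MvPolynomial (Fin (m + 2)) K}
    (h : killLast K (m + 1) p ∈ genIdeal K m r r) :
    ∃ c, p - X (Fin.last (m + 1)) * c ∈ esymmIdeal K (m + 2) r (m + 1) := by
  rw [← esymmIdeal_top_eq, ← map_killLast_esymmIdeal (m + 1) hr, killLast_mem_map_iff] at h
  obtain ⟨x, hx, y, hy, rfl⟩ := Submodule.mem_sup.1 h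
  obtain ⟨c, rfl⟩ := Ideal.mem_span_singleton.1 hy
  exact ⟨c, by simpa using hx⟩

theorem killLast_mem_of_mem_esymmIdeal (hr : 0 < r) {p : MvPolynomial (Fin (m + 2)) K}
    (h : p ∈ esymmIdeal K (m + 2) r (m + 1)) : killLast K (m + 1) p ∈ genIdeal K m r r := by
  rw [← esymmIdeal_top_eq, ← map_killLast_esymmIdeal (m + 1) hr]
  exact Ideal.mem_map_of_mem _ h

theorem mem_genIdeal_succ_iff {p : MvPolynomial (Fin (m + 2)) K} :
    p ∈ genIdeal K (m + 1) r s ↔ ∃ b, p - X (Fin.last (m + 1)) ^ s *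
      (rename Fin.castSucc ((∏ i, X i) ^ s) * b) ∈ esymmIdeal K (m + 2) r (m + 1) := by
  rw [mem_genIdeal_iff]
  refine exists_congr fun b => ?_
  rw [prod_X_succ, mul_pow, map_pow, mul_comm (_ ^ s) (_ ^ s), mul_assoc]

theorem exists_prod_X_pow_eq (m r : ℕ) : ∃ ε : MvPolynomial (Fin (m + 2)) K,
    rename Fin.castSucc ((∏ i, X i) ^ r) - X (Fin.last (m + 1)) ^ (r * (m + 1)) * ε ∈
      esymmIdeal K (m + 2) r (m + 1) := by
  refine ⟨(-1) ^ (m + 1), ?_⟩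
  have h := rename_prod_X_pow_sub_mem (K := K) m r
  rwa [neg_pow, ← pow_mul, mul_comm ((-1) ^ (m + 1))] at h

/-- Modulo `e_1(x^r), …, e_{n-1}(x^r)`, the colon ideal `(z^j : P^s)` is `(z^j, P^(r-s))`, where `z`
is the last variable, `P` the product of the other ones, and `j ≤ r (n - 1)`. The reason is that
`P^r` is `z^(r (n - 1))` up to sign, so that one can compute modulo `z` and proceed by induction on
`j`. -/
theorem exists_of_prod_X_pow_mul_mem (hsr : s < r) {j : ℕ} (hj : j ≤ r * (m + 1))
    {a b : MvPolynomial (Fin (m + 2)) K}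
    (h : rename Fin.castSucc ((∏ i, X i) ^ s) * b - X (Fin.last (m + 1)) ^ j * a ∈
      esymmIdeal K (m + 2) r (m + 1)) :
    ∃ b₁ b₂, b - X (Fin.last (m + 1)) ^ j * b₁ - rename Fin.castSucc ((∏ i, X i) ^ (r - s)) * b₂ ∈
      esymmIdeal K (m + 2) r (m + 1) := by
  have hr : 0 < r := by omega
  obtain ⟨ε, hε⟩ := exists_prod_X_pow_eq (K := K) m r
  rw [show r = s + (r - s) by omega, pow_add, map_mul, show s + (r - s) = r by omega] at hε
  induction j generalizing a b with
  | zero => exact ⟨b, 0, by simp⟩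
  | succ j ih =>
    have h1 := killLast_mem_of_mem_esymmIdeal hr h
    rw [map_sub, map_mul, map_mul, map_pow (killLast K (m + 1)) (X _), killLast_X_last,
      zero_pow (Nat.succ_ne_zero j),
      zero_mul, sub_zero, killLast_rename, prod_X_pow_mul_mem_iff hsr, mem_genIdeal_iff] at h1
    obtain ⟨c, hc⟩ := h1
    have h2 : killLast K (m + 1)
        (b - rename Fin.castSucc ((∏ i, X i) ^ (r - s)) * rename Fin.castSucc c) ∈
        genIdeal K m r r := by
      rw [map_sub, map_mul, killLast_rename, killLast_rename]
      exact esymmIdeal_le_genIdeal m r r hc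
    obtain ⟨b', hb'⟩ := exists_sub_X_last_mul_mem hr h2
    set P := rename (Fin.castSucc (n := m + 1)) ((∏ i, X i : MvPolynomial (Fin (m + 1)) K) ^ s)
    set Q := rename (Fin.castSucc (n := m + 1))
      ((∏ i, X i : MvPolynomial (Fin (m + 1)) K) ^ (r - s))
    set z : MvPolynomial (Fin (m + 2)) K := X (Fin.last (m + 1))
    set c' := rename (Fin.castSucc (n := m + 1)) c
    have hpow : z ^ (r * (m + 1)) = z ^ (j + 1) * z ^ (r * (m + 1) - (j + 1)) := by
      rw [← pow_add, Nat.add_sub_cancel' hj]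
    have h3 : P * b' - z ^ j * (a - z ^ (r * (m + 1) - (j + 1)) * ε * c') ∈
        esymmIdeal K (m + 2) r (m + 1) := by
      apply regularMod_X_esymmIdeal hr le_rfl (Fin.last (m + 1))
      have h4 := sub_mem (sub_mem h (Ideal.mul_mem_left _ P hb')) (Ideal.mul_mem_left _ c' hε)
      convert h4 using 1
      rw [hpow]
      ring
    obtain ⟨b₁, b₂, h5⟩ := ih (by omega) h3
    refine ⟨b₁, c' + z * b₂, ?_⟩
    convert add_mem hb' (Ideal.mul_mem_left _ z h5) using 1
    ring

theorem mk_mem_colonAdd_iff {k : ℕ} {a : MvPolynomial (Fin (m + 1)) K} :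
    Ideal.Quotient.mk _ a ∈ colonAdd (lastVar K m r s) k ↔
      ∃ c, X (Fin.last m) ^ k * (a - X (Fin.last m) * c) ∈ genIdeal K m r s := by
  rw [mem_colonAdd, (Ideal.Quotient.mk_surjective (I := genIdeal K m r s)).exists]
  refine exists_congr fun c => ?_
  rw [lastVar, ← map_pow, ← map_mul, ← map_sub, ← map_mul, Ideal.Quotient.eq_zero_iff_mem]

/-- For `k < s`, the ideal `(0 : z^k) + (z)` is `(z)`. -/
theorem mk_mem_colonAdd_of_lt (hr : 0 < r) {k : ℕ} (hk : k < s)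
    {a : MvPolynomial (Fin (m + 2)) K} :
    Ideal.Quotient.mk _ a ∈ colonAdd (lastVar K (m + 1) r s) k ↔
      killLast K (m + 1) a ∈ genIdeal K m r r := by
  rw [mk_mem_colonAdd_iff]
  constructor
  · rintro ⟨c, hc⟩
    obtain ⟨b, hb⟩ := mem_genIdeal_succ_iff.1 hc
    have h1 := (regularMod_X_esymmIdeal hr le_rfl (Fin.last (m + 1))).pow k
      (a - X (Fin.last (m + 1)) * c - X (Fin.last (m + 1)) ^ (s - k) *
        (rename Fin.castSucc ((∏ i, X i) ^ s) * b)) (by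
        convert hb using 1
        rw [mul_sub, ← mul_assoc (_ ^ k) (_ ^ (s - k)), ← pow_add, Nat.add_sub_cancel' hk.le])
    have h2 := killLast_mem_of_mem_esymmIdeal hr h1
    simpa [zero_pow (Nat.sub_ne_zero_of_lt hk)] using h2
  · intro h
    obtain ⟨c, hc⟩ := exists_sub_X_last_mul_mem hr h
    exact ⟨c, Ideal.mul_mem_left _ _ (esymmIdeal_le_genIdeal _ _ _ hc)⟩

theorem exists_sub_prod_X_pow_mul_mem {a : MvPolynomial (Fin (m + 2)) K}
    (h : killLast K (m + 1) a ∈ genIdeal K m r s) :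
    ∃ p, killLast K (m + 1) (a - rename Fin.castSucc ((∏ i, X i) ^ s) * p) ∈ genIdeal K m r r := by
  obtain ⟨c, hc⟩ := mem_genIdeal_iff.1 h
  refine ⟨rename Fin.castSucc c, ?_⟩
  rw [map_sub, map_mul, killLast_rename, killLast_rename]
  exact esymmIdeal_le_genIdeal m r r hc

/-- For `s ≤ k < r (n - 1) + s`, the ideal `(0 : z^k) + (z)` is `(P^s, z)`, where `P` is the product
of the variables other than `z`. -/
theorem mk_mem_colonAdd_of_le (hsr : s < r) {k : ℕ} (hsk : s ≤ k) (hk : k < r * (m + 1) + s)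
    {a : MvPolynomial (Fin (m + 2)) K} :
    Ideal.Quotient.mk _ a ∈ colonAdd (lastVar K (m + 1) r s) k ↔
      killLast K (m + 1) a ∈ genIdeal K m r s := by
  have hr : 0 < r := by omega
  rw [mk_mem_colonAdd_iff]
  constructor
  · rintro ⟨c, hc⟩
    obtain ⟨b, hb⟩ := mem_genIdeal_succ_iff.1 hc
    have h1 := (regularMod_X_esymmIdeal hr le_rfl (Fin.last (m + 1))).pow s
      (X (Fin.last (m + 1)) ^ (k - s) * (a - X (Fin.last (m + 1)) * c) -
        (rename Fin.castSucc ((∏ i, X i) ^ s) * b)) (by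
        convert hb using 1
        rw [mul_sub, ← mul_assoc (_ ^ s) (_ ^ (k - s)), ← pow_add, Nat.add_sub_cancel' hsk])
    obtain ⟨b₁, b₂, h2⟩ := exists_of_prod_X_pow_mul_mem hsr (j := k - s) (by omega) (b := b)
      (a := a - X (Fin.last (m + 1)) * c) (by
        convert neg_mem h1 using 1
        ring)
    obtain ⟨ε, hε⟩ := exists_prod_X_pow_eq (K := K) m r
    rw [show r = s + (r - s) by omega, pow_add, map_mul, show s + (r - s) = r by omega] at hε
    have h3 := (regularMod_X_esymmIdeal hr le_rfl (Fin.last (m + 1))).pow (k - s)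
      (a - X (Fin.last (m + 1)) * c - rename Fin.castSucc ((∏ i, X i) ^ s) * b₁ -
        X (Fin.last (m + 1)) ^ (r * (m + 1) - (k - s)) * (ε * b₂)) (by
        have h4 := add_mem (add_mem h1 (Ideal.mul_mem_left _
          (rename Fin.castSucc ((∏ i, X i) ^ s)) h2)) (Ideal.mul_mem_left _ b₂ hε)
        convert h4 using 1
        rw [show (X (Fin.last (m + 1)) : MvPolynomial (Fin (m + 2)) K) ^ (r * (m + 1)) =
          X (Fin.last (m + 1)) ^ (k - s) * X (Fin.last (m + 1)) ^ (r * (m + 1) - (k - s)) by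
            rw [← pow_add, Nat.add_sub_cancel' (by omega)]]
        ring)
    have h5 := genIdeal_le hsr.le (killLast_mem_of_mem_esymmIdeal hr h3)
    rw [map_sub, map_sub, map_sub, map_mul, map_mul, map_mul, map_pow (killLast K (m + 1)) (X _),
      killLast_X_last, zero_mul, sub_zero, zero_pow (Nat.sub_ne_zero_of_lt (by omega)), zero_mul,
      sub_zero, killLast_rename] at h5
    have h6 := add_mem h5 (Ideal.mul_mem_right (killLast K (m + 1) b₁) _
      (prod_X_pow_mem_genIdeal (K := K) m r s))
    rwa [sub_add_cancel] at h6
  · intro h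
    obtain ⟨p, hp⟩ := exists_sub_prod_X_pow_mul_mem h
    obtain ⟨c, hc⟩ := exists_sub_X_last_mul_mem hr hp
    refine ⟨c, ?_⟩
    have h1 := add_mem (Ideal.mul_mem_left _ (X (Fin.last (m + 1)) ^ k)
      (esymmIdeal_le_genIdeal (m + 1) r s hc)) (Ideal.mul_mem_left _
        (X (Fin.last (m + 1)) ^ (k - s) * p) (prod_X_pow_mul_X_last_pow_mem (K := K) m r s))
    convert h1 using 1
    rw [show (X (Fin.last (m + 1)) : MvPolynomial (Fin (m + 2)) K) ^ k =
      X (Fin.last (m + 1)) ^ (k - s) * X (Fin.last (m + 1)) ^ s by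
        rw [← pow_add, Nat.sub_add_cancel hsk]]
    ring

theorem lastVar_pow_eq_zero (hsr : s ≤ r) :
    lastVar K (m + 1) r s ^ (r * (m + 1) + s) = 0 := by
  rw [lastVar, ← map_pow, Ideal.Quotient.eq_zero_iff_mem]
  exact X_last_pow_mem_genIdeal m hsr

theorem colonAdd_eq_top (hsr : s ≤ r) {k : ℕ} (hk : r * (m + 1) + s ≤ k) :
    colonAdd (lastVar K (m + 1) r s) k = ⊤ := by
  rw [Ideal.eq_top_iff_one, mem_colonAdd]
  refine ⟨0, ?_⟩
  rw [mul_zero, sub_zero, mul_one, ← Nat.add_sub_cancel' hk, pow_add, lastVar_pow_eq_zero hsr,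
    zero_mul]

theorem one_notMem_genIdeal (hr : 0 < r) (hs : 0 < s) :
    (1 : MvPolynomial (Fin (m + 1)) K) ∉ genIdeal K m r s :=
  fun h => genIdeal_ne_top hr hs ((Ideal.eq_top_iff_one _).2 h)

/-- The filtration `(0 : z^k) + (z)` takes the three values `(z) ⊂ (P^s, z) ⊂ A`, and jumps at `s`
and at `r (n - 1) + s`. -/
theorem not_colonAdd_succ_le_iff (hs : 0 < s) (hsr : s < r) (k : ℕ) :
    ¬ colonAdd (lastVar K (m + 1) r s) (k + 1) ≤ colonAdd (lastVar K (m + 1) r s) k ↔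
      k + 1 = r * (m + 1) + s ∨ k + 1 = s := by
  have hr : 0 < r := hs.trans hsr
  have hF : 0 < r * (m + 1) := by positivity
  constructor
  · contrapose!
    rintro ⟨h1, h2⟩ a ha
    obtain ⟨p, rfl⟩ := Ideal.Quotient.mk_surjective a
    rcases lt_or_gt_of_ne h2 with h2 | h2
    · rw [mk_mem_colonAdd_of_lt hr h2] at ha
      rwa [mk_mem_colonAdd_of_lt hr (by omega)]
    · rcases lt_or_gt_of_ne h1 with h1 | h1
      · rw [mk_mem_colonAdd_of_le hsr (by omega) h1] at ha
        rwa [mk_mem_colonAdd_of_le hsr (by omega) (by omega)]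
      · rw [colonAdd_eq_top hsr.le (by omega)]
        trivial
  · rintro (h | h) hle
    · rw [h, colonAdd_eq_top hsr.le le_rfl] at hle
      have h1 : Ideal.Quotient.mk (genIdeal K (m + 1) r s) 1 ∈
          colonAdd (lastVar K (m + 1) r s) k := hle trivial
      rw [mk_mem_colonAdd_of_le hsr (by omega) (by omega), map_one] at h1
      exact one_notMem_genIdeal hr hs h1
    · have h1 : Ideal.Quotient.mk (genIdeal K (m + 1) r s)
          (rename Fin.castSucc ((∏ i, X i) ^ s)) ∈ colonAdd (lastVar K (m + 1) r s) k := by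
        apply hle
        rw [mk_mem_colonAdd_of_le hsr (by omega) (by omega), killLast_rename]
        exact prod_X_pow_mem_genIdeal m r s
      rw [mk_mem_colonAdd_of_lt hr (by omega), killLast_rename, ← mul_one (_ ^ s),
        prod_X_pow_mul_mem_iff hsr] at h1
      exact one_notMem_genIdeal hr (by omega) h1

end Colon

/-! ### The central simple modules -/

section CentralSimpleModules

open MvPolynomial

variable {K : Type*} [Field K]

/-- A graded module which is generated by one element `u₀` of degree `d` is isomorphic, up to the
shift `d`, to the quotient of `P` by the annihilator of `u₀`. -/
theorem isoUpToShift_of_generator {P A B U : Type*} [CommRing P] [Algebra K P] [CommRing A]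
    [Algebra K A] [CommRing B] [Algebra K B] [AddCommGroup U] [Module K U] [Module A U]
    [IsScalarTower K A U] {π : P →ₐ[K] A} {ρ : P →ₐ[K] B} {𝒰 : ℕ → Submodule K U}
    {ℬ : ℕ → Submodule K B} (𝒮 : ℕ → Submodule K P) (hρ : Function.Surjective ρ)
    (hℬ : ∀ i, ℬ i = (𝒮 i).map ρ.toLinearMap) (u₀ : U) (hu₀ : ∀ u, ∃ p, π p • u₀ = u)
    (hker : ∀ p, π p • u₀ = 0 ↔ ρ p = 0) (d : ℕ) (hd : ∀ i, i < d → 𝒰 i = ⊥)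
    (h𝒰 : ∀ i u, u ∈ 𝒰 (i + d) ↔ ∃ p ∈ 𝒮 i, π p • u₀ = u) :
    IsoUpToShift π ρ 𝒰 ℬ := by
  let f : P →ₗ[K] U := ((LinearMap.toSpanSingleton A U u₀).restrictScalars K) ∘ₗ π.toLinearMap
  have hf (p) : f p = π p • u₀ := rfl
  have hfsurj : Function.Surjective f := hu₀
  have hk : LinearMap.ker f = LinearMap.ker ρ.toLinearMap := by
    ext p
    exact hker p
  let e : U ≃ₗ[K] B := (f.quotKerEquivOfSurjective hfsurj).symm.trans
    ((Submodule.quotEquivOfEq _ _ hk).trans (ρ.toLinearMap.quotKerEquivOfSurjective hρ))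
  have he (p) : e (π p • u₀) = ρ p := by
    have : (f.quotKerEquivOfSurjective hfsurj).symm (f p) = Submodule.Quotient.mk p := by
      rw [LinearEquiv.symm_apply_eq]; rfl
    simp only [e, LinearEquiv.trans_apply]
    rw [← hf, this]
    rfl
  refine ⟨e, fun p u => ?_, d, hd, fun i => ?_⟩
  · obtain ⟨q, rfl⟩ := hu₀ u
    rw [smul_smul, ← map_mul, he, he, map_mul]
  · rw [hℬ]
    ext x
    constructor
    · rintro ⟨u, hu, rfl⟩
      obtain ⟨p, hp, rfl⟩ := (h𝒰 i u).1 hu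
      exact ⟨p, hp, (he p).symm⟩
    · rintro ⟨p, hp, rfl⟩
      exact ⟨π p • u₀, (h𝒰 i _).2 ⟨p, hp, rfl⟩, he p⟩

/-- A subquotient `𝔞/𝔟` of `K[σ]/I` by homogeneous ideals which is generated by the class of one
form `w`, of degree `d`, is a quotient of `K[σ]` up to the shift `d`. -/
theorem isoUpToShift_subquotient {σ B : Type*} [CommRing B] [Algebra K B]
    {I : Ideal (MvPolynomial σ K)} (𝔞 𝔟 : Ideal (MvPolynomial σ K ⧸ I))
    {ρ : MvPolynomial σ K →ₐ[K] B} {ℬ : ℕ → Submodule K B} (hρ : Function.Surjective ρ)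
    (hℬ : ∀ i, ℬ i = (homogeneousSubmodule σ K i).map ρ.toLinearMap)
    {w : MvPolynomial σ K} {d : ℕ} (hw : w.IsHomogeneous d) (hwa : Ideal.Quotient.mk I w ∈ 𝔞)
    (hgen : ∀ p, Ideal.Quotient.mk I p ∈ 𝔞 → ∃ q, Ideal.Quotient.mk I (p - w * q) ∈ 𝔟)
    (hker : ∀ q, Ideal.Quotient.mk I (w * q) ∈ 𝔟 ↔ ρ q = 0)
    (hhom : ∀ p, Ideal.Quotient.mk I p ∈ 𝔟 → ∀ n,
      Ideal.Quotient.mk I (homogeneousComponent n p) ∈ 𝔟) :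
    IsoUpToShift (U := ↥𝔞 ⧸ 𝔟.submoduleOf 𝔞) (Ideal.Quotient.mkₐ K I) ρ
      (fun k => ((quotientGrading I k).comap (𝔞.subtype.restrictScalars K)).map
        ((𝔟.submoduleOf 𝔞).mkQ.restrictScalars K)) ℬ := by
  let mkU (p : MvPolynomial σ K) (hp : Ideal.Quotient.mk I p ∈ 𝔞) : ↥𝔞 ⧸ 𝔟.submoduleOf 𝔞 :=
    Submodule.Quotient.mk ⟨Ideal.Quotient.mk I p, hp⟩
  have hwq (q) : Ideal.Quotient.mk I (w * q) ∈ 𝔞 := by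
    rw [map_mul]; exact 𝔞.mul_mem_right _ hwa
  have hsmul (q) : Ideal.Quotient.mkₐ K I q • mkU w hwa = mkU (w * q) (hwq q) := by
    rw [← Submodule.Quotient.mk_smul]
    congr 1
    apply Subtype.ext
    change Ideal.Quotient.mk I q * Ideal.Quotient.mk I w = Ideal.Quotient.mk I (w * q)
    rw [map_mul, mul_comm]
  have heq {p q} (hp : Ideal.Quotient.mk I p ∈ 𝔞) (hq : Ideal.Quotient.mk I q ∈ 𝔞)
      (h : Ideal.Quotient.mk I (p - q) ∈ 𝔟) : mkU p hp = mkU q hq := by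
    rw [Submodule.Quotient.eq]
    change Ideal.Quotient.mk I p - Ideal.Quotient.mk I q ∈ 𝔟
    rwa [← map_sub]
  have hmem (k u) : u ∈ (((quotientGrading I k).comap (𝔞.subtype.restrictScalars K)).map
        ((𝔟.submoduleOf 𝔞).mkQ.restrictScalars K)) ↔
      ∃ (p : MvPolynomial σ K) (hp : Ideal.Quotient.mk I p ∈ 𝔞),
        p.IsHomogeneous k ∧ mkU p hp = u := by
    constructor
    · rintro ⟨⟨a, ha⟩, ⟨p, hp, rfl⟩, rfl⟩
      exact ⟨p, ha, hp, rfl⟩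
    · rintro ⟨p, ha, hp, rfl⟩
      exact ⟨⟨_, ha⟩, ⟨p, hp, rfl⟩, rfl⟩
  refine isoUpToShift_of_generator (homogeneousSubmodule σ K) hρ hℬ (mkU w hwa) (fun u => ?_)
    (fun p => ?_) d (fun i hi => ?_) (fun i u => ?_)
  · obtain ⟨⟨a, ha⟩, rfl⟩ := Submodule.Quotient.mk_surjective _ u
    obtain ⟨p, rfl⟩ := Ideal.Quotient.mk_surjective a
    obtain ⟨q, hq⟩ := hgen p ha
    refine ⟨q, ?_⟩
    rw [hsmul]
    exact (heq ha (hwq q) hq).symm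
  · rw [hsmul, ← hker, Submodule.Quotient.mk_eq_zero]
    rfl
  · rw [eq_bot_iff]
    intro u hu
    obtain ⟨p, ha, hp, rfl⟩ := (hmem i u).1 hu
    obtain ⟨q, hq⟩ := hgen p ha
    have h1 := hhom _ hq i
    rw [map_sub, homogeneousComponent_eq_self hp, homogeneousComponent_mul_left_of_lt hw q hi,
      sub_zero] at h1
    rw [Submodule.mem_bot, Submodule.Quotient.mk_eq_zero]
    exact h1
  · rw [hmem]
    constructor
    · rintro ⟨p, ha, hp, rfl⟩
      obtain ⟨q, hq⟩ := hgen p ha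
      have h1 := hhom _ hq (i + d)
      rw [map_sub, homogeneousComponent_eq_self hp,
        homogeneousComponent_mul_left hw q (Nat.le_add_left d i), Nat.add_sub_cancel] at h1
      refine ⟨_, homogeneousComponent_isHomogeneous i q, ?_⟩
      rw [hsmul]
      exact (heq ha (hwq _) h1).symm
    · rintro ⟨q, hq, rfl⟩
      exact ⟨w * q, hwq q, by rw [add_comm]; exact hw.mul hq, (hsmul q).symm⟩

theorem killLast_homogeneousComponent (n d : ℕ) (p : MvPolynomial (Fin (n + 1)) K) :
    killLast K n (homogeneousComponent d p) = homogeneousComponent d (killLast K n p) := by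
  conv_rhs => rw [← sum_homogeneousComponent p, map_sum, map_sum]
  simp_rw [homogeneousComponent_of_mem
    (killLast_isHomogeneous (homogeneousComponent_isHomogeneous _ p))]
  by_cases hd : d ∈ Finset.range (p.totalDegree + 1)
  · rw [Finset.sum_eq_single_of_mem _ hd fun e _ he => if_neg (Ne.symm he), if_pos rfl]
  · rw [homogeneousComponent_eq_zero _ _ (by rw [Finset.mem_range] at hd; omega), map_zero]
    exact (Finset.sum_eq_zero fun e he => if_neg (by rintro rfl; exact hd he)).symm

theorem quotientGrading_eq_map_killLast {n : ℕ} (J : Ideal (MvPolynomial (Fin n) K)) (i : ℕ) :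
    quotientGrading J i = (homogeneousSubmodule (Fin (n + 1)) K i).map
      ((Ideal.Quotient.mkₐ K J).comp (killLast K n)).toLinearMap := by
  ext x
  constructor
  · rintro ⟨p, hp, rfl⟩
    refine ⟨rename Fin.castSucc p, hp.rename_isHomogeneous, ?_⟩
    change Ideal.Quotient.mk J (killLast K n (rename Fin.castSucc p)) = _
    rw [killLast_rename]
    rfl
  · rintro ⟨p, hp, rfl⟩
    exact ⟨killLast K n p, killLast_isHomogeneous hp, rfl⟩

/-- The first central simple module is `A/(P^s, z)`, generated by the class of `1`. -/
theorem isoReduced_first {m r s : ℕ} (hs : 0 < s) (hsr : s < r) {l : List ℕ}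
    (hl : l.dedup = [r * (m + 1) + s, s]) :
    IsoReduced K (m + 1) r s s (centralSimpleGrading (quotientGrading (genIdeal K (m + 1) r s))
      (lastVar K (m + 1) r s) l 0) := by
  have hr : 0 < r := hs.trans hsr
  have hF : 0 < r * (m + 1) := by positivity
  have h0 : distinctSize l 0 = r * (m + 1) + s := by rw [distinctSize, hl]; rfl
  have h1 : distinctSize l (0 + 1) = s := by rw [distinctSize, hl]; rfl
  have htop : colonAdd (lastVar K (m + 1) r s) (distinctSize l 0) = ⊤ := by
    rw [h0, colonAdd_eq_top hsr.le le_rfl]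
  have hb (p) : Ideal.Quotient.mk _ p ∈ colonAdd (lastVar K (m + 1) r s) (distinctSize l (0 + 1)) ↔
      killLast K (m + 1) p ∈ genIdeal K m r s := by
    rw [h1, mk_mem_colonAdd_of_le hsr le_rfl (by omega)]
  refine isoUpToShift_subquotient _ _
    ((Ideal.Quotient.mkₐ_surjective K _).comp (killLast_surjective _))
    (quotientGrading_eq_map_killLast _) (isHomogeneous_one (Fin (m + 2)) K) ?_ ?_ ?_ ?_
  · rw [htop]; trivial
  · intro p _
    refine ⟨p, ?_⟩
    rw [one_mul, sub_self, map_zero]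
    exact zero_mem _
  · intro q
    rw [one_mul, hb, AlgHom.comp_apply, Ideal.Quotient.mkₐ_eq_mk, Ideal.Quotient.eq_zero_iff_mem,
      reducedIdeal_succ m hr]
  · intro p hp n
    rw [hb] at hp ⊢
    rw [killLast_homogeneousComponent]
    exact homogeneousComponent_mem_genIdeal hp n

/-- The second central simple module is `(P^s, z)/(z)`, generated by the class of `P^s`, whose
annihilator is the colon ideal of `prod_X_pow_mul_mem_iff`. -/
theorem isoReduced_second {m r s : ℕ} (hs : 0 < s) (hsr : s < r) {l : List ℕ}
    (hl : l.dedup = [r * (m + 1) + s, s]) :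
    IsoReduced K (m + 1) r s (r - s)
      (centralSimpleGrading (quotientGrading (genIdeal K (m + 1) r s))
        (lastVar K (m + 1) r s) l 1) := by
  have hr : 0 < r := hs.trans hsr
  have hF : 0 < r * (m + 1) := by positivity
  have h1 : distinctSize l 1 = s := by rw [distinctSize, hl]; rfl
  have h2 : distinctSize l (1 + 1) = 0 := by rw [distinctSize, hl]; rfl
  have ha (p) : Ideal.Quotient.mk _ p ∈ colonAdd (lastVar K (m + 1) r s) (distinctSize l 1) ↔
      killLast K (m + 1) p ∈ genIdeal K m r s := by
    rw [h1, mk_mem_colonAdd_of_le hsr le_rfl (by omega)]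
  have hb (p) : Ideal.Quotient.mk _ p ∈ colonAdd (lastVar K (m + 1) r s) (distinctSize l (1 + 1)) ↔
      killLast K (m + 1) p ∈ genIdeal K m r r := by
    rw [h2, mk_mem_colonAdd_of_lt hr hs]
  refine isoUpToShift_subquotient _ _
    ((Ideal.Quotient.mkₐ_surjective K _).comp (killLast_surjective _))
    (quotientGrading_eq_map_killLast _)
    ((isHomogeneous_prod_X_pow (K := K) (m + 1) s).rename_isHomogeneous (f := Fin.castSucc))
    ?_ ?_ ?_ ?_
  · rw [ha, killLast_rename]
    exact prod_X_pow_mem_genIdeal m r s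
  · intro p hp
    obtain ⟨q, hq⟩ := exists_sub_prod_X_pow_mul_mem ((ha p).1 hp)
    exact ⟨q, (hb _).2 hq⟩
  · intro q
    rw [hb, map_mul, killLast_rename, prod_X_pow_mul_mem_iff hsr, AlgHom.comp_apply,
      Ideal.Quotient.mkₐ_eq_mk, Ideal.Quotient.eq_zero_iff_mem, reducedIdeal_succ m hr]
  · intro p hp n
    rw [hb] at hp ⊢
    rw [killLast_homogeneousComponent]
    exact homogeneousComponent_mem_genIdeal hp n

end CentralSimpleModules

end CentralSimple

end

theorem mainTheorem11 {K : Type*} [Field K] [CharZero K] (m r s : ℕ) (hs : 0 < s) (hsr : s < r) :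
    RingTheory.Sequence.IsRegular (MvPolynomial (Fin (m + 1)) K)
      (List.ofFn (CentralSimple.gen K m r s)) ∧
    CentralSimple.HasSLP (CentralSimple.quotientGrading (CentralSimple.genIdeal K m r s)) ∧
    (1 ≤ m →
      (∃ l : List ℕ, CentralSimple.IsJordanBlockSizes
        (LinearMap.mulLeft K (CentralSimple.lastVar K m r s)) l) ∧
      ∀ l : List ℕ, CentralSimple.IsJordanBlockSizes
        (LinearMap.mulLeft K (CentralSimple.lastVar K m r s)) l →
        l.dedup.length = 2 ∧
        CentralSimple.IsoReduced K m r s s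
          (CentralSimple.centralSimpleGrading
            (CentralSimple.quotientGrading (CentralSimple.genIdeal K m r s))
            (CentralSimple.lastVar K m r s) l 0) ∧
        CentralSimple.IsoReduced K m r s (r - s)
          (CentralSimple.centralSimpleGrading
            (CentralSimple.quotientGrading (CentralSimple.genIdeal K m r s))
            (CentralSimple.lastVar K m r s) l 1)) := by
  have hr : 0 < r := hs.trans hsr
  have hslp := CentralSimple.hasSLP_genIdeal (K := K) m hs hsr
  refine ⟨CentralSimple.isRegular_gen hr hs, hslp, fun hm => ?_⟩
  obtain ⟨m, rfl⟩ : ∃ m', m = m' + 1 := ⟨m - 1, by omega⟩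
  have hfin := hslp.1
  refine ⟨CentralSimple.exists_isJordanBlockSizes ⟨r * (m + 1) + s, ?_⟩, fun l hl => ?_⟩
  · rw [LinearMap.pow_mulLeft, CentralSimple.lastVar_pow_eq_zero hsr.le]
    exact LinearMap.mulLeft_zero_eq_zero K _
  · have hF : 0 < r * (m + 1) := by positivity
    have hdedup := hl.dedup_eq hs (F := r * (m + 1) + s) (by omega)
      (CentralSimple.not_colonAdd_succ_le_iff hs hsr)
    exact ⟨by rw [hdedup]; rfl, CentralSimple.isoReduced_first hs hsr hdedup,
      CentralSimple.isoReduced_second hs hsr hdedup⟩
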